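/- Work with symmetric functions over $\mathbb{Q}$ in infinitely many variables. For a partition $\mu$ let $\ell(\mu)$ be its number of parts, $m_i(\mu)$ the number of parts equal to $i$, $p_\mu=\prod_i p_{\mu_i}$ the power sum and $m_\mu$ the monomial symmetric function; put $\tilde p_k=p_k/k$, $\tilde p_\mu=\prod_i\tilde p_{\mu_i}$, and let $\tilde m_\mu=\bigl(\prod_{i\ge1}m_i(\mu)!\bigr)\,m_\mu$ be the augmented monomial symmetric function. For a partition $\lambda$ of $n$, expand the Schur function as $s_\lambda=\sum_{\mu\vdash n}a_\mu p_\mu$ with $a_\mu\in\mathbb{Q}$; the bottom Schur function $\hat s_\lambda$ is its part of lowest degree with respect to $\deg p_\mu=\ell(\mu)$, that is, $\hat s_\lambda=\sum_{\ell(\mu)=r}a_\mu p_\mu$, where $r=\min\{\ell(\mu): a_\mu\neq0\}$. **Theorem.** For every $n \ge 0$ and every partition $\lambda$ of $n$, the bottom Schur function $\hat s_\lambda$ is well defined and can be written in exactly one way as $\hat s_\lambda=\sum_{\mu\vdash n}c_\mu\tilde p_\mu$ with $c_\mu\in\mathbb{Q}$, and these coefficients satisfy $$\sum_{\mu\vdash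 n}c_\mu\,p_\mu=\sum_{\mu\vdash n}c_\mu\,\tilde m_\mu .$$ -/

import Mathlib

/-!
Symmetric functions over `ℚ` are formal power series in the variables `x₀, x₁, x₂, …`, that is,
elements of `MvPowerSeries ℕ ℚ`, given here by their coefficients.
-/

noncomputable section

namespace BottomSchur

open Classical in
/-- The power sum symmetric function `p_k = ∑ i, x_i ^ k` (for `k ≥ 1`). -/
def psum (k : ℕ) : MvPowerSeries ℕ ℚ :=
  fun d => if ∃ i : ℕ, d = Finsupp.single i k then 1 else 0

/-- `p_μ = ∏ i, p_{μ_i}`. -/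
def psumPart {n : ℕ} (μ : n.Partition) : MvPowerSeries ℕ ℚ :=
  (μ.parts.map psum).prod

/-- `p̃_μ = ∏ i, p̃_{μ_i}`, where `p̃_k = p_k / k`. -/
def psumTildePart {n : ℕ} (μ : n.Partition) : MvPowerSeries ℕ ℚ :=
  (μ.parts.map fun k : ℕ => (1 / (k : ℚ)) • psum k).prod

/-- The monomial symmetric function `m_μ`: the sum of all distinct monomials whose nonzero
exponents, in some order, are the parts of `μ`. -/
def msymm {n : ℕ} (μ : n.Partition) : MvPowerSeries ℕ ℚ :=
  fun d => if d.support.val.map d = μ.parts then 1 else 0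

/-- The augmented monomial symmetric function `m̃_μ = (∏ i, m_i(μ)!) m_μ`, where `m_i(μ)` is the
number of parts of `μ` equal to `i`. -/
def augMsymm {n : ℕ} (μ : n.Partition) : MvPowerSeries ℕ ℚ :=
  ((∏ i ∈ μ.parts.toFinset, (μ.parts.count i).factorial : ℕ) : ℚ) • msymm μ

/-- The content of a semistandard tableau: the exponent vector that counts, for each `i`, the
cells containing the entry `i`. -/
def content {Y : YoungDiagram} (T : SemistandardYoungTableau Y) : ℕ →₀ ℕ :=
  ∑ c ∈ Y.cells, Finsupp.single (T c.1 c.2) 1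

/-- The Schur function `s_Y = ∑ T, x ^ T`, over all semistandard tableaux `T` of shape `Y`.
Only finitely many tableaux have a given content. -/
def schur (Y : YoungDiagram) : MvPowerSeries ℕ ℚ :=
  fun d => (Nat.card {T : SemistandardYoungTableau Y // content T = d} : ℚ)

/-- `g` is the lowest degree part of the symmetric function `f` of degree `n`, where
`deg p_μ = ℓ(μ)`: if `f = ∑ a_μ p_μ` and `r` is the least length of a partition `μ` with
`a_μ ≠ 0`, then `g` is the sum of the terms `a_μ p_μ` with `ℓ(μ) = r`. -/
def IsLowestDegreePart (n : ℕ) (f g : MvPowerSeries ℕ ℚ) : Prop :=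
  ∃ (a : n.Partition → ℚ) (r : ℕ),
    f = ∑ μ, a μ • psumPart μ ∧
    IsLeast {l | ∃ μ : n.Partition, a μ ≠ 0 ∧ Multiset.card μ.parts = l} r ∧
    g = ∑ μ with Multiset.card μ.parts = r, a μ • psumPart μ

/-- `g` is the bottom Schur function `ŝ_Y`: the lowest degree part of `s_Y`. -/
def IsBottomSchur (Y : YoungDiagram) (g : MvPowerSeries ℕ ℚ) : Prop :=
  IsLowestDegreePart Y.card (schur Y) g

end BottomSchur

end

/-! Let ℓ_0 < ℓ_1 < … < ℓ_{N-1} be the row lengths of the shape in increasing order, zeros allowed,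
with i added to the i-th one. Jacobi–Trudi says s_λ = det(h_{ℓ_i - j}). It is proved by induction on
the number of variables: the branching rule for tableaux (`trunc_succ_schur`) and row operations on
Toeplitz minors (`toeplitzMinor_eq_sum`) give the same recursion. Newton's identities make h_k a
polynomial in z_k = p_k / k, with linear part z_k for k > 0, so by `schur_eq` everything happens in
a polynomial ring in which ℓ(μ) is the ordinary degree.

Multiply the Jacobi–Trudi matrix by the unitriangular Toeplitz matrix of the inverse series of ∑ h_k
t^k. A row with ℓ_i < N becomes a unit vector; a row with ℓ_i ≥ N becomes (z_{ℓ_i - j})_j up to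
terms of degree at least 2. The part of least degree is therefore the determinant of `bottomMatrix`,
provided it is nonzero; the specialization z_k = 1/k, which produces Cauchy-type rows 1/(ℓ_i - j),
shows that it is (`det_bottomMatrix_ne_zero`).

The c_μ are thus the coefficients of that determinant in the z_k. Substitute p_k = ∑ x^k for z_k.
The result is a sum, over all maps f from the rows with ℓ_i ≥ N to the variables, of determinants
with entries x_{f(i)}^{ℓ_i - j} in those rows. If f takes a value twice, two rows are proportional
and the determinant vanishes, so only injective f contribute. Restricting to injective f is exactly
the passage from p_μ to m̃_μ (`trunc_prod_psum`, `trunc_augMonomial`), which gives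
`psumHom_det_bottomMatrix`. The uniqueness claims follow from `linearIndependent_psumPart`. -/

noncomputable section

namespace BottomSchur

open Finset

/-! ### Specialization to finitely many variables. -/

/-- The part of a power series that does not involve the variables `x_i` with `i ≥ n`. -/
def truncFun (n : ℕ) (f : MvPowerSeries ℕ ℚ) : MvPowerSeries ℕ ℚ :=
  fun d => if d.support ⊆ range n then MvPowerSeries.coeff d f else 0

theorem coeff_truncFun (n : ℕ) (f : MvPowerSeries ℕ ℚ) (d : ℕ →₀ ℕ) :
    MvPowerSeries.coeff d (truncFun n f) =
      if d.support ⊆ range n then MvPowerSeries.coeff d f else 0 := rfl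

theorem truncFun_C (n : ℕ) (r : ℚ) :
    truncFun n (MvPowerSeries.C r) = MvPowerSeries.C r := by
  ext d
  rw [coeff_truncFun, MvPowerSeries.coeff_C]
  split_ifs <;> simp_all

theorem truncFun_mul (n : ℕ) (f g : MvPowerSeries ℕ ℚ) :
    truncFun n (f * g) = truncFun n f * truncFun n g := by
  ext d
  rw [coeff_truncFun, MvPowerSeries.coeff_mul, MvPowerSeries.coeff_mul]
  simp only [coeff_truncFun]
  split_ifs with h
  · refine sum_congr rfl fun p hp => ?_
    have hp' := mem_antidiagonal.1 hp
    have h1 : p.1.support ⊆ range n :=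
      (Finsupp.support_mono (hp' ▸ le_self_add)).trans h
    have h2 : p.2.support ⊆ range n :=
      (Finsupp.support_mono (hp' ▸ le_add_self)).trans h
    rw [if_pos h1, if_pos h2]
  · refine (sum_eq_zero fun p hp => ?_).symm
    have hp' := mem_antidiagonal.1 hp
    by_cases h1 : p.1.support ⊆ range n
    · have h2 : ¬ p.2.support ⊆ range n := fun h2 => h (by
        rw [← hp']
        exact Finsupp.support_add.trans (union_subset h1 h2))
      rw [if_neg h2, mul_zero]
    · rw [if_neg h1, zero_mul]

/-- The specialization of a power series that sets `x_i = 0` for all `i ≥ n`. -/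
def trunc (n : ℕ) : MvPowerSeries ℕ ℚ →ₐ[ℚ] MvPowerSeries ℕ ℚ where
  toFun := truncFun n
  map_one' := truncFun_C n 1
  map_zero' := by
    ext d
    simp [coeff_truncFun]
  map_add' f g := by
    ext d
    simp only [coeff_truncFun, map_add]
    split_ifs <;> simp
  commutes' r := truncFun_C n r
  map_mul' f g := truncFun_mul n f g

theorem coeff_trunc (n : ℕ) (f : MvPowerSeries ℕ ℚ) (d : ℕ →₀ ℕ) :
    MvPowerSeries.coeff d (trunc n f) =
      if d.support ⊆ range n then MvPowerSeries.coeff d f else 0 := rfl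

theorem ext_of_trunc {f g : MvPowerSeries ℕ ℚ} (h : ∀ n, trunc n f = trunc n g) : f = g := by
  ext d
  obtain ⟨n, hn⟩ := d.support.exists_nat_subset_range
  have := congrArg (MvPowerSeries.coeff d) (h n)
  simpa [coeff_trunc, hn] using this

open Classical in
theorem coeff_psum (k : ℕ) (d : ℕ →₀ ℕ) :
    MvPowerSeries.coeff d (psum k) = if ∃ i : ℕ, d = Finsupp.single i k then 1 else 0 := rfl

theorem trunc_psum (n : ℕ) {k : ℕ} (hk : k ≠ 0) :
    trunc n (psum k) = ∑ i ∈ range n, (MvPowerSeries.X i) ^ k := by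
  classical
  ext d
  rw [coeff_trunc, map_sum]
  simp only [MvPowerSeries.coeff_X_pow, coeff_psum]
  by_cases h : ∃ i, d = Finsupp.single i k
  · obtain ⟨i, rfl⟩ := h
    have : ∀ j, Finsupp.single i k = Finsupp.single j k ↔ i = j := fun j =>
      ⟨fun h => (Finsupp.single_left_injective hk) h, fun h => h ▸ rfl⟩
    simp [this, Finsupp.support_single _ hk]
  · rw [if_neg h, sum_eq_zero]
    · simp
    · intro i _
      exact if_neg fun h' => h ⟨i, h'⟩

/-! ### Minors of Toeplitz matrices. -/

section Toeplitz

variable {R S : Type*} [CommRing R] [CommRing S]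

/-- The minor `det (g_{ℓ i - j})` of the Toeplitz matrix of the power series `∑ g_k t^k`. -/
def toeplitzMinor {N : ℕ} (G : PowerSeries R) (ℓ : Fin N → ℕ) : R :=
  (Matrix.of fun i j : Fin N => PowerSeries.coeff (ℓ i) (PowerSeries.X ^ (j : ℕ) * G)).det

theorem map_toeplitzMinor {N : ℕ} (f : R →+* S) (G : PowerSeries R) (ℓ : Fin N → ℕ) :
    f (toeplitzMinor G ℓ) = toeplitzMinor (PowerSeries.map f G) ℓ := by
  rw [toeplitzMinor, toeplitzMinor, RingHom.map_det]
  refine congrArg Matrix.det (Matrix.ext fun i j => ?_)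
  simp [PowerSeries.coeff_X_pow_mul', apply_ite f]

/-- Multiplication by 1 - x t replaces g_s by g_s - x g_{s-1}; weighted by powers of x these
differences telescope. -/
theorem coeff_eq_sum_Ico_add (x : R) (G : PowerSeries R) {a b : ℕ} (hab : a ≤ b) :
    PowerSeries.coeff b G =
      ∑ s ∈ Ico (a + 1) (b + 1), x ^ (b - s) *
        PowerSeries.coeff s ((1 - PowerSeries.C x * PowerSeries.X) * G) +
      x ^ (b - a) * PowerSeries.coeff a G := by
  induction b, hab using Nat.le_induction with
  | base => simp
  | succ b hab ih =>
    rw [sum_Ico_succ_top (by lia)]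
    have h1 : ∑ s ∈ Ico (a + 1) (b + 1), x ^ (b + 1 - s) *
        PowerSeries.coeff s ((1 - PowerSeries.C x * PowerSeries.X) * G) =
        x * ∑ s ∈ Ico (a + 1) (b + 1), x ^ (b - s) *
        PowerSeries.coeff s ((1 - PowerSeries.C x * PowerSeries.X) * G) := by
      rw [mul_sum]
      refine sum_congr rfl fun s hs => ?_
      rw [mem_Ico] at hs
      rw [show b + 1 - s = (b - s) + 1 by lia]
      ring
    have h2 : PowerSeries.coeff (b + 1) ((1 - PowerSeries.C x * PowerSeries.X) * G) =
        PowerSeries.coeff (b + 1) G - x * PowerSeries.coeff b G := by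
      rw [sub_mul, one_mul, mul_assoc, map_sub, PowerSeries.coeff_C_mul,
        PowerSeries.coeff_succ_X_mul]
    rw [h1, h2, show b + 1 - a = (b - a) + 1 by lia, Nat.sub_self, pow_zero, pow_succ]
    linear_combination x * ih

theorem coeff_eq_sum_Ico (x : R) (G : PowerSeries R) (b : ℕ) :
    PowerSeries.coeff b G =
      ∑ s ∈ Ico 0 (b + 1), x ^ (b - s) *
        PowerSeries.coeff s ((1 - PowerSeries.C x * PowerSeries.X) * G) := by
  rw [sum_eq_sum_Ico_succ_bot (by lia), coeff_eq_sum_Ico_add x G (Nat.zero_le b)]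
  simp
  ring

/-- The smallest values of a sequence that interlaces with `ℓ`. -/
def interlaceBound {M : ℕ} (ℓ : Fin (M + 1) → ℕ) : Fin (M + 1) → ℕ :=
  Fin.cons 0 fun i => ℓ i.castSucc + 1

/-- Subtracting from each row the right power of x times the previous row leaves, by the telescoping
identity, a combination of rows of the new Toeplitz matrix with index between consecutive ℓ's.
Multilinearity of the determinant then yields the sum over interlacing sequences, the algebraic
counterpart of the branching rule. -/
theorem toeplitzMinor_eq_sum {M : ℕ} (x : R) (G : PowerSeries R) (ℓ : Fin (M + 1) → ℕ)
    (hℓ : StrictMono ℓ) :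
    toeplitzMinor G ℓ =
      ∑ s ∈ Fintype.piFinset fun i => Ico (interlaceBound ℓ i) (ℓ i + 1),
        x ^ (∑ i, (ℓ i - s i)) *
          toeplitzMinor ((1 - PowerSeries.C x * PowerSeries.X) * G) s := by
  set G' := (1 - PowerSeries.C x * PowerSeries.X) * G with hG'
  have hmul : ∀ j : ℕ, (1 - PowerSeries.C x * PowerSeries.X) * (PowerSeries.X ^ j * G) =
      PowerSeries.X ^ j * G' := fun j => by rw [hG']; ring
  have key : toeplitzMinor G ℓ = Matrix.detRowAlternating
      (fun i => ∑ s ∈ Ico (interlaceBound ℓ i) (ℓ i + 1), x ^ (ℓ i - s) •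
        fun j : Fin (M + 1) => PowerSeries.coeff s (PowerSeries.X ^ (j : ℕ) * G')) := by
    refine Matrix.det_eq_of_forall_row_eq_smul_add_pred
      (fun i => x ^ (ℓ i.succ - ℓ i.castSucc)) (fun j => ?_) (fun i j => ?_)
    · simp only [Matrix.of_apply, interlaceBound, Fin.cons_zero, Finset.sum_apply, Pi.smul_apply,
        smul_eq_mul, ← hmul]
      exact coeff_eq_sum_Ico x _ _
    · simp only [Matrix.of_apply, interlaceBound, Fin.cons_succ, Finset.sum_apply, Pi.smul_apply,
        smul_eq_mul, ← hmul]
      exact coeff_eq_sum_Ico_add x _ (hℓ (Fin.castSucc_lt_succ)).le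
  rw [key, ← AlternatingMap.coe_multilinearMap, MultilinearMap.map_sum_finset]
  refine sum_congr rfl fun s _ => ?_
  rw [MultilinearMap.map_smul_univ, prod_pow_eq_pow_sum, smul_eq_mul]
  rfl

theorem toeplitzMinor_one {N : ℕ} (ℓ : Fin N → ℕ) (hℓ : StrictMono ℓ) :
    toeplitzMinor (1 : PowerSeries R) ℓ = if ∀ i, ℓ i = i then 1 else 0 := by
  rw [toeplitzMinor]
  split_ifs with h
  · rw [← Matrix.det_one (n := Fin N) (R := R)]
    refine congrArg Matrix.det (Matrix.ext fun i j => ?_)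
    simp [h, PowerSeries.coeff_X_pow, Matrix.one_apply, Fin.ext_iff]
  -- A strictly increasing self-map of `Fin N` is the identity, so any other ℓ leaves the range, and
  -- its row in the matrix of the constant series 1 is zero.
  · obtain ⟨i, hi⟩ : ∃ i, N ≤ ℓ i := by
      by_contra! hlt
      apply h
      have : StrictMono fun i => (⟨ℓ i, hlt i⟩ : Fin N) := fun a b hab => hℓ hab
      intro i
      have h1 := congrArg Fin.val (DFunLike.congr_fun (Subsingleton.elim
        (StrictMono.orderIsoOfSurjective _ this (Finite.injective_iff_surjective.1 this.injective))
        (OrderIso.refl _)) i)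
      simpa using h1
    refine Matrix.det_eq_zero_of_row_eq_zero i fun j => ?_
    have : ℓ i ≠ j := by have := j.2; lia
    simp [PowerSeries.coeff_X_pow, this]

end Toeplitz

end BottomSchur

end

/-! ### The branching rule for semistandard tableaux. -/

noncomputable section

namespace BottomSchur

open Finset

theorem content_apply {Y : YoungDiagram} (T : SemistandardYoungTableau Y) (v : ℕ) :
    content T v = #{c ∈ Y.cells | T c.1 c.2 = v} := by
  rw [content, Finsupp.finsetSum_apply, card_filter]
  exact sum_congr rfl fun c _ => by rw [Finsupp.single_apply]

theorem mem_support_content {Y : YoungDiagram} (T : SemistandardYoungTableau Y) {i j : ℕ}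
    (h : (i, j) ∈ Y) : T i j ∈ (content T).support := by
  rw [Finsupp.mem_support_iff, content_apply, Finset.card_ne_zero]
  exact ⟨(i, j), by simpa using h⟩

instance finite_content_eq (Y : YoungDiagram) (d : ℕ →₀ ℕ) :
    Finite {T : SemistandardYoungTableau Y // content T = d} := by
  refine Finite.of_injective
    (β := Y.cells → d.support)
    (fun T c => ⟨T.1 c.1.1 c.1.2, by
      have := mem_support_content T.1 (i := c.1.1) (j := c.1.2) c.2
      rwa [T.2] at this⟩) fun T T' h => ?_
  refine Subtype.ext (SemistandardYoungTableau.ext fun i j => ?_)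
  by_cases hc : (i, j) ∈ Y
  · exact congrArg Subtype.val (congrFun h ⟨(i, j), hc⟩)
  · rw [T.1.zeros hc, T'.1.zeros hc]

/-- `Y'` interlaces with `Y` if `Y / Y'` is a horizontal strip. -/
def Interlaces (Y' Y : YoungDiagram) : Prop :=
  Y' ≤ Y ∧ ∀ i j, (i + 1, j) ∈ Y → (i, j) ∈ Y'

theorem finite_interlaces (Y : YoungDiagram) : {Y' | Interlaces Y' Y}.Finite := by
  refine Set.Finite.of_finite_image (f := YoungDiagram.cells)
    (Y.cells.powerset.finite_toSet.subset ?_) fun A _ B _ h => YoungDiagram.ext h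
  rintro _ ⟨A, hA, rfl⟩
  simpa using YoungDiagram.cells_subset_iff.2 hA.1

/-- The finite set of Young diagrams that interlace with `Y`. -/
def interlacing (Y : YoungDiagram) : Finset YoungDiagram := (finite_interlaces Y).toFinset

theorem mem_interlacing {Y Y' : YoungDiagram} : Y' ∈ interlacing Y ↔ Interlaces Y' Y := by
  simp [interlacing]

/-- The cells of a tableau whose entries are less than `n`. -/
def below {Y : YoungDiagram} (n : ℕ) (T : SemistandardYoungTableau Y) : YoungDiagram where
  cells := {c ∈ Y.cells | T c.1 c.2 < n}
  isLowerSet := by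
    rintro ⟨i, j⟩ ⟨i', j'⟩ ⟨h1, h2⟩ h
    simp only [coe_filter, YoungDiagram.mem_cells, Set.mem_ofPred_eq] at h ⊢
    refine ⟨Y.up_left_mem h1 h2 h.1, lt_of_le_of_lt ?_ h.2⟩
    exact (T.col_weak h1 (Y.up_left_mem le_rfl h2 h.1)).trans (T.row_weak_of_le h2 h.1)

theorem mem_below {Y : YoungDiagram} {n : ℕ} {T : SemistandardYoungTableau Y} {i j : ℕ} :
    (i, j) ∈ below n T ↔ (i, j) ∈ Y ∧ T i j < n := by
  rw [← YoungDiagram.mem_cells, below]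
  simp

theorem below_interlaces {Y : YoungDiagram} {n : ℕ} {T : SemistandardYoungTableau Y}
    (hT : (content T).support ⊆ range (n + 1)) : Interlaces (below n T) Y := by
  refine ⟨?_, fun i j h => mem_below.2 ⟨Y.up_left_mem (Nat.le_succ i) le_rfl h, ?_⟩⟩
  · rintro ⟨i, j⟩ h
    exact (mem_below.1 h).1
  · have h1 := T.col_strict (Nat.lt_succ_self i) h
    have h2 := mem_range.1 (hT (mem_support_content T h))
    lia

theorem content_eq_card_sub {Y : YoungDiagram} {n : ℕ} {T : SemistandardYoungTableau Y}
    (hT : (content T).support ⊆ range (n + 1)) :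
    content T n = Y.card - (below n T).card := by
  rw [content_apply]
  have h1 : Y.cells.filter (fun c => T c.1 c.2 = n) =
      Y.cells.filter (fun c => ¬ T c.1 c.2 < n) := by
    refine filter_congr fun c hc => ?_
    have := mem_range.1 (hT (mem_support_content T (i := c.1) (j := c.2) hc))
    lia
  have h2 := card_filter_add_card_filter_not (s := Y.cells) (fun c => T c.1 c.2 < n)
  rw [h1]
  change _ = Y.cells.card - (filter _ _).card
  lia

/-- Restriction of a tableau to a smaller diagram. -/
def restrict {Y Y' : YoungDiagram} (h : Y' ≤ Y) (T : SemistandardYoungTableau Y) :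
    SemistandardYoungTableau Y' where
  entry i j := if (i, j) ∈ Y' then T i j else 0
  row_weak' {i j1 j2} hj hc := by
    rw [if_pos hc, if_pos (Y'.up_left_mem le_rfl hj.le hc)]
    exact T.row_weak hj (h hc)
  col_strict' {i1 i2 j} hi hc := by
    rw [if_pos hc, if_pos (Y'.up_left_mem hi.le le_rfl hc)]
    exact T.col_strict hi (h hc)
  zeros' hc := if_neg hc

theorem restrict_apply {Y Y' : YoungDiagram} (h : Y' ≤ Y) (T : SemistandardYoungTableau Y)
    (i j : ℕ) : restrict h T i j = if (i, j) ∈ Y' then T i j else 0 := rfl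

/-- Extension of a tableau with entries less than `n` along a horizontal strip, by `n`. -/
def extend {Y Y' : YoungDiagram} (h : Interlaces Y' Y) (n : ℕ) (T : SemistandardYoungTableau Y')
    (hT : ∀ i j, (i, j) ∈ Y' → T i j < n) : SemistandardYoungTableau Y where
  entry i j := if (i, j) ∈ Y' then T i j else if (i, j) ∈ Y then n else 0
  row_weak' {i j1 j2} hj hc := by
    have h1 := Y.up_left_mem le_rfl hj.le hc
    by_cases h2 : (i, j2) ∈ Y'
    · rw [if_pos h2, if_pos (Y'.up_left_mem le_rfl hj.le h2)]
      exact T.row_weak hj h2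
    · rw [if_neg h2, if_pos hc]
      split_ifs with h3
      · exact (hT _ _ h3).le
      · exact le_rfl
  col_strict' {i1 i2 j} hi hc := by
    have h1 : (i1, j) ∈ Y' := h.2 _ _ (Y.up_left_mem hi le_rfl hc)
    rw [if_pos h1]
    split_ifs with h2
    · exact T.col_strict hi h2
    · exact hT _ _ h1
  zeros' {i j} hc := by
    rw [if_neg fun h' => hc (h.1 h'), if_neg hc]

theorem extend_apply {Y Y' : YoungDiagram} (h : Interlaces Y' Y) (n : ℕ)
    (T : SemistandardYoungTableau Y') (hT : ∀ i j, (i, j) ∈ Y' → T i j < n) (i j : ℕ) :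
    extend h n T hT i j = if (i, j) ∈ Y' then T i j else if (i, j) ∈ Y then n else 0 := rfl

theorem content_restrict_below {Y Y' : YoungDiagram} (n : ℕ) {T : SemistandardYoungTableau Y}
    (h : Y' ≤ Y) (hY' : below n T = Y') (hT : (content T).support ⊆ range (n + 1)) :
    content (restrict h T) = (content T).erase n := by
  subst hY'
  ext v
  have h1 : content (restrict h T) v = #{c ∈ Y.cells | T c.1 c.2 < n ∧ T c.1 c.2 = v} := by
    rw [content_apply, ← filter_filter]
    refine congrArg card (filter_congr fun c hc => ?_)
    rw [restrict_apply, if_pos ((YoungDiagram.mem_cells _).1 hc)]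
  rw [h1, Finsupp.erase_apply]
  split_ifs with hv
  · rw [card_eq_zero, filter_eq_empty_iff]
    rintro c - ⟨h2, h3⟩
    lia
  · rw [content_apply]
    refine congrArg card (filter_congr fun c hc => ?_)
    have := mem_range.1 (hT (mem_support_content T (i := c.1) (j := c.2) hc))
    lia

theorem below_extend {Y Y' : YoungDiagram} (h : Interlaces Y' Y) (n : ℕ)
    (T : SemistandardYoungTableau Y') (hT : ∀ i j, (i, j) ∈ Y' → T i j < n) :
    below n (extend h n T hT) = Y' := by
  refine SetLike.ext fun ⟨i, j⟩ => ?_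
  rw [mem_below, extend_apply]
  by_cases h1 : (i, j) ∈ Y'
  · simp [h1, h.1 h1, hT i j h1]
  · by_cases h2 : (i, j) ∈ Y <;> simp [h1, h2]

theorem restrict_extend {Y Y' : YoungDiagram} (h : Interlaces Y' Y) (n : ℕ)
    (T : SemistandardYoungTableau Y') (hT : ∀ i j, (i, j) ∈ Y' → T i j < n) :
    restrict h.1 (extend h n T hT) = T := by
  ext i j
  rw [restrict_apply, extend_apply]
  split_ifs with h1
  · rfl
  · exact (T.zeros h1).symm

theorem support_content_extend {Y Y' : YoungDiagram} (h : Interlaces Y' Y) (n : ℕ)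
    (T : SemistandardYoungTableau Y') (hT : ∀ i j, (i, j) ∈ Y' → T i j < n) :
    (content (extend h n T hT)).support ⊆ range (n + 1) := by
  intro v hv
  rw [Finsupp.mem_support_iff, content_apply, card_ne_zero] at hv
  obtain ⟨⟨i, j⟩, hc⟩ := hv
  rw [mem_filter, extend_apply] at hc
  obtain ⟨-, rfl⟩ := hc
  dsimp only
  rw [mem_range]
  split_ifs with h1
  · exact (hT i j h1).trans (Nat.lt_succ_self n)
  · lia
  · lia

/-- The tableaux of shape `Y` whose entries less than `n` fill the diagram `Y'` are the tableaux
of shape `Y'`. -/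
def fiberEquiv {Y Y' : YoungDiagram} (h : Interlaces Y' Y) {n : ℕ} {d : ℕ →₀ ℕ}
    (hd : d.support ⊆ range (n + 1)) (hn : d n = Y.card - Y'.card) :
    {T : {T : SemistandardYoungTableau Y // content T = d} // below n T.1 = Y'} ≃
      {T : SemistandardYoungTableau Y' // content T = d.erase n} :=
  have hlt : ∀ T : {T : SemistandardYoungTableau Y' // content T = d.erase n},
      ∀ i j, (i, j) ∈ Y' → T.1 i j < n := fun T i j hc => by
    have h1 := mem_support_content T.1 hc
    rw [T.2, Finsupp.support_erase, mem_erase] at h1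
    have h2 := mem_range.1 (hd h1.2)
    lia
  { toFun T := ⟨restrict h.1 T.1.1, by
      rw [content_restrict_below n h.1 T.2 (T.1.2.symm ▸ hd), T.1.2]⟩
    invFun T := ⟨⟨extend h n T.1 (hlt T), by
      have h1 := support_content_extend h n T.1 (hlt T)
      have h2 := content_restrict_below n h.1 (below_extend h n T.1 (hlt T)) h1
      have h3 := content_eq_card_sub h1
      rw [restrict_extend, T.2] at h2
      rw [below_extend, ← hn] at h3
      ext v
      by_cases hv : v = n
      · rw [hv, h3]
      · have := DFunLike.congr_fun h2 v
        rw [Finsupp.erase_ne hv, Finsupp.erase_ne hv] at this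
        exact this.symm⟩, below_extend h n T.1 (hlt T)⟩
    left_inv T := by
      refine Subtype.ext (Subtype.ext (SemistandardYoungTableau.ext fun i j => ?_))
      dsimp only
      rw [extend_apply, restrict_apply]
      have hb : (i, j) ∈ Y' ↔ (i, j) ∈ Y ∧ T.1.1 i j < n := by
        rw [← mem_below, T.2]
      split_ifs with h1 h2
      · rfl
      · have h3 := mem_support_content T.1.1 h2
        rw [T.1.2] at h3
        have h4 := mem_range.1 (hd h3)
        by_contra h5
        exact h1 (hb.2 ⟨h2, by lia⟩)
      · exact (T.1.1.zeros h2).symm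
    right_inv T := Subtype.ext (restrict_extend h n T.1 (hlt T)) }

theorem coeff_schur (Y : YoungDiagram) (d : ℕ →₀ ℕ) :
    MvPowerSeries.coeff d (schur Y) =
      (Nat.card {T : SemistandardYoungTableau Y // content T = d} : ℚ) := rfl

/-- Tableaux are sorted by the shape of their entries below the largest variable index n. By column
strictness the cells holding n form a horizontal strip, and their number is the exponent of x_n. -/
theorem coeff_schur_eq_sum (Y : YoungDiagram) {n : ℕ} {d : ℕ →₀ ℕ}
    (hd : d.support ⊆ range (n + 1)) :
    MvPowerSeries.coeff d (schur Y) = ∑ Y' ∈ interlacing Y,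
      if d n = Y.card - Y'.card then MvPowerSeries.coeff (d.erase n) (schur Y') else 0 := by
  classical
  simp only [coeff_schur]
  let _ : Fintype {T : SemistandardYoungTableau Y // content T = d} := Fintype.ofFinite _
  rw [Nat.card_eq_fintype_card, ← card_univ, card_eq_sum_card_fiberwise
    (f := fun T : {T : SemistandardYoungTableau Y // content T = d} => below n T.1)
    (t := interlacing Y) fun T _ => mem_interlacing.2 (below_interlaces (T.2.symm ▸ hd))]
  push_cast
  refine sum_congr rfl fun Y' hY' => ?_
  rw [← Fintype.card_subtype, ← Nat.card_eq_fintype_card]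
  split_ifs with hn
  · rw [Nat.card_congr (fiberEquiv (mem_interlacing.1 hY') hd hn)]
  · rw [Nat.cast_eq_zero, Nat.card_eq_zero]
    refine Or.inl ⟨fun T => hn ?_⟩
    rw [← T.1.2, content_eq_card_sub (T.1.2.symm ▸ hd), T.2]

theorem trunc_succ_schur (n : ℕ) (Y : YoungDiagram) :
    trunc (n + 1) (schur Y) = ∑ Y' ∈ interlacing Y,
      MvPowerSeries.X n ^ (Y.card - Y'.card) * trunc n (schur Y') := by
  classical
  ext d
  rw [coeff_trunc, map_sum]
  simp only [MvPowerSeries.X_pow_eq, MvPowerSeries.coeff_monomial_mul, coeff_trunc, one_mul]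
  split_ifs with hd
  · rw [coeff_schur_eq_sum Y hd]
    refine sum_congr rfl fun Y' _ => ?_
    generalize Y.card - Y'.card = e
    by_cases h1 : e ≤ d n
    · rw [if_pos (Finsupp.single_le_iff.2 h1)]
      by_cases h2 : d n = e
      · have h3 : d - Finsupp.single n e = d.erase n := by
          ext v
          by_cases hv : v = n
          · subst hv; simp [h2]
          · simp [Finsupp.erase_ne hv, Ne.symm hv]
        rw [if_pos h2, h3, if_pos]
        intro v hv
        rw [Finsupp.support_erase, mem_erase] at hv
        have := mem_range.1 (hd hv.2)
        rw [mem_range]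
        lia
      -- If the exponent of x_n exceeds e, dividing by x_n^e leaves a monomial that still contains
      -- x_n, which the truncation kills.
      · rw [if_neg h2, if_neg]
        intro h
        have : n ∈ range n := h (by
          rw [Finsupp.mem_support_iff, Finsupp.tsub_apply, Finsupp.single_eq_same]
          lia)
        simp at this
    · rw [if_neg (by lia), if_neg (mt Finsupp.single_le_iff.1 h1)]
  · refine (sum_eq_zero fun Y' _ => ?_).symm
    split_ifs with h1 h2
    · exfalso
      apply hd
      intro v hv
      rw [mem_range]
      by_cases hvn : v = n
      · lia
      · have : v ∈ range n := h2 (by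
          rw [Finsupp.mem_support_iff] at hv ⊢
          simpa [Finsupp.single_apply, Ne.symm hvn] using hv)
        have := mem_range.1 this
        lia
    · rfl
    · rfl

end BottomSchur

end

/-! ### Shifted row lengths and the Jacobi–Trudi identity. -/

noncomputable section

namespace BottomSchur

open Finset

/-- The strictly increasing sequence of shifted row lengths of a Young diagram with at most
`M + 1` rows. -/
def beta (M : ℕ) (Y : YoungDiagram) (i : Fin (M + 1)) : ℕ := Y.rowLen (M - i) + i

theorem strictMono_beta (M : ℕ) (Y : YoungDiagram) : StrictMono (beta M Y) := by
  intro i j h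
  have h1 := Y.rowLen_anti (M - j) (M - i) (by lia)
  have h2 : (i : ℕ) < j := h
  simp only [beta]
  lia

theorem le_iff_rowLen_le {Y Y' : YoungDiagram} : Y' ≤ Y ↔ ∀ k, Y'.rowLen k ≤ Y.rowLen k := by
  constructor
  · intro h k
    by_contra! hlt
    exact absurd (YoungDiagram.mem_iff_lt_rowLen.1 (h (YoungDiagram.mem_iff_lt_rowLen.2 hlt)))
      (lt_irrefl _)
  · rintro h ⟨i, j⟩ hc
    exact YoungDiagram.mem_iff_lt_rowLen.2 ((YoungDiagram.mem_iff_lt_rowLen.1 hc).trans_le (h i))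

theorem interlaces_iff {Y Y' : YoungDiagram} :
    Interlaces Y' Y ↔ ∀ k, Y'.rowLen k ≤ Y.rowLen k ∧ Y.rowLen (k + 1) ≤ Y'.rowLen k := by
  rw [Interlaces, le_iff_rowLen_le, forall_and]
  refine and_congr_right fun _ => ⟨fun h k => ?_, fun h i j hc => ?_⟩
  · by_contra! hlt
    exact absurd (YoungDiagram.mem_iff_lt_rowLen.1
      (h _ _ (YoungDiagram.mem_iff_lt_rowLen.2 hlt))) (lt_irrefl _)
  · exact YoungDiagram.mem_iff_lt_rowLen.2 ((YoungDiagram.mem_iff_lt_rowLen.1 hc).trans_le (h i))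

theorem ext_of_rowLen {Y Y' : YoungDiagram} (h : ∀ k, Y.rowLen k = Y'.rowLen k) : Y = Y' :=
  le_antisymm (le_iff_rowLen_le.2 fun k => (h k).le) (le_iff_rowLen_le.2 fun k => (h k).ge)

theorem exists_rowLen_eq {f : ℕ → ℕ} (hf : Antitone f) {K : ℕ} (hK : f K = 0) :
    ∃ Y : YoungDiagram, ∀ k, Y.rowLen k = f k := by
  let Y : YoungDiagram :=
    { cells := {c ∈ range K ×ˢ range (f 0) | c.2 < f c.1}
      isLowerSet := by
        rintro ⟨i, j⟩ ⟨i', j'⟩ ⟨h1, h2⟩ h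
        simp only [coe_filter, mem_product, mem_range, Set.mem_ofPred_eq] at h ⊢
        dsimp only at h1 h2
        have := hf h1
        lia }
  have hmem : ∀ i j, (i, j) ∈ Y ↔ j < f i := by
    intro i j
    rw [← YoungDiagram.mem_cells]
    simp only [Y, mem_filter, mem_product, mem_range]
    refine ⟨fun h => h.2, fun h => ⟨⟨?_, h.trans_le (hf (Nat.zero_le i))⟩, h⟩⟩
    by_contra! hle
    have := hf hle
    lia
  refine ⟨Y, fun k => eq_of_forall_lt_iff fun j => ?_⟩
  rw [← YoungDiagram.mem_iff_lt_rowLen, hmem]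

theorem card_eq_sum_rowLen {M : ℕ} {Y : YoungDiagram} (hM : Y.rowLen (M + 1) = 0) :
    Y.card = ∑ i : Fin (M + 1), Y.rowLen (M - i) := by
  rw [Fin.sum_univ_eq_sum_range (fun i => Y.rowLen (M - i)) (M + 1),
    ← sum_range_reflect, YoungDiagram.card, card_eq_sum_card_fiberwise (f := Prod.fst)
      (t := range (M + 1))]
  · refine sum_congr rfl fun k hk => ?_
    rw [mem_range] at hk
    rw [show M - (M + 1 - 1 - k) = k by lia, YoungDiagram.rowLen_eq_card]
    rfl
  · rintro ⟨i, j⟩ hc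
    by_contra h
    have h1 : M + 1 ≤ i := by simpa using h
    have h2 := YoungDiagram.mem_iff_lt_rowLen.1 ((YoungDiagram.mem_cells _).1 hc)
    have h3 := Y.rowLen_anti _ _ h1
    lia

theorem sum_beta {M : ℕ} {Y : YoungDiagram} (hM : Y.rowLen (M + 1) = 0) :
    ∑ i, beta M Y i = Y.card + ∑ i : Fin (M + 1), (i : ℕ) := by
  rw [card_eq_sum_rowLen hM, ← sum_add_distrib]
  rfl

theorem mem_piFinset_interlaceBound {M : ℕ} {ℓ s : Fin (M + 1) → ℕ} :
    (s ∈ Fintype.piFinset fun i => Ico (interlaceBound ℓ i) (ℓ i + 1)) ↔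
      (∀ i, s i ≤ ℓ i) ∧ ∀ i : Fin M, ℓ i.castSucc < s i.succ := by
  simp only [Fintype.mem_piFinset, mem_Ico, forall_and, Nat.lt_succ_iff]
  rw [and_comm]
  refine and_congr_right fun _ => ?_
  rw [Fin.forall_fin_succ]
  simp [interlaceBound]

theorem beta_mem_of_interlaces {M : ℕ} {Y Y' : YoungDiagram} (h : Interlaces Y' Y) :
    beta M Y' ∈ Fintype.piFinset fun i => Ico (interlaceBound (beta M Y) i) (beta M Y i + 1) := by
  rw [interlaces_iff] at h
  rw [mem_piFinset_interlaceBound]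
  refine ⟨fun i => Nat.add_le_add_right (h _).1 _, fun i => ?_⟩
  have := (h (M - (i + 1))).2
  rw [show M - (i + 1) + 1 = M - i by lia] at this
  simp only [beta, Fin.val_castSucc, Fin.val_succ]
  lia

theorem exists_interlaces_beta_eq {M : ℕ} {Y : YoungDiagram} (hM : Y.rowLen (M + 1) = 0)
    {s : Fin (M + 1) → ℕ}
    (hs : s ∈ Fintype.piFinset fun i => Ico (interlaceBound (beta M Y) i) (beta M Y i + 1)) :
    ∃ Y', Interlaces Y' Y ∧ beta M Y' = s := by
  rw [mem_piFinset_interlaceBound] at hs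
  obtain ⟨hs1, hs2⟩ := hs
  let f : ℕ → ℕ := fun k => if h : k ≤ M then s ⟨M - k, by lia⟩ - (M - k) else 0
  have hf0 : ∀ k, M < k → f k = 0 := fun k hk => dif_neg (by lia)
  -- This makes the natural-number subtraction in `f` exact, so that adding the shift back recovers
  -- s.
  have hlow : ∀ i : Fin (M + 1), (i : ℕ) ≤ s i := by
    intro i
    induction i using Fin.cases with
    | zero => simp
    | succ i =>
      have := hs2 i
      simp only [beta, Fin.val_castSucc] at this
      simp only [Fin.val_succ]
      lia
  have hle : ∀ k, f k ≤ Y.rowLen k := by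
    intro k
    by_cases hk : k ≤ M
    · have := hs1 ⟨M - k, by lia⟩
      simp only [beta, show M - (M - k) = k by lia] at this
      simp only [f, dif_pos hk]
      lia
    · rw [hf0 k (by lia)]
      exact Nat.zero_le _
  have hge : ∀ k, Y.rowLen (k + 1) ≤ f k := by
    intro k
    by_cases hk : k < M
    · have := hs2 ⟨M - k - 1, by lia⟩
      simp only [beta, Fin.castSucc_mk, Fin.succ_mk, show M - (M - k - 1) = k + 1 by lia,
        show M - k - 1 + 1 = M - k by lia] at this
      simp only [f, dif_pos hk.le]
      lia
    · have := Y.rowLen_anti (M + 1) (k + 1) (by lia)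
      lia
  obtain ⟨Y', hY'⟩ := exists_rowLen_eq
    (antitone_nat_of_succ_le fun k => (hle (k + 1)).trans (hge k)) (hf0 (M + 1) (by lia))
  refine ⟨Y', interlaces_iff.2 fun k => ?_, funext fun i => ?_⟩
  · rw [hY']
    exact ⟨hle k, hge k⟩
  · have h1 := hlow i
    have h2 : (⟨M - (M - i), by lia⟩ : Fin (M + 1)) = i := Fin.ext (by dsimp only; lia)
    simp only [beta, hY', f, dif_pos (Nat.sub_le M i), h2]
    lia

theorem beta_injOn {M : ℕ} {Y Y' : YoungDiagram} (hY : Y.rowLen (M + 1) = 0)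
    (hY' : Y'.rowLen (M + 1) = 0) (h : beta M Y = beta M Y') : Y = Y' := by
  refine ext_of_rowLen fun k => ?_
  by_cases hk : k ≤ M
  · have := congrFun h ⟨M - k, by lia⟩
    simp only [beta, show M - (M - k) = k by lia] at this
    lia
  · have h1 := Y.rowLen_anti (M + 1) k (by lia)
    have h2 := Y'.rowLen_anti (M + 1) k (by lia)
    lia

theorem interlaces_rowLen_eq_zero {Y Y' : YoungDiagram} (h : Interlaces Y' Y) {k : ℕ}
    (hk : Y.rowLen k = 0) : Y'.rowLen k = 0 :=
  Nat.le_zero.1 (hk ▸ (interlaces_iff.1 h k).1)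

/-- The generating function `∑ h_k t^k` of the complete homogeneous symmetric polynomials in
`x_0, …, x_{n-1}`. -/
def completeSeries (n : ℕ) : PowerSeries (MvPowerSeries ℕ ℚ) :=
  ∏ i ∈ range n, PowerSeries.mk fun k => (MvPowerSeries.X i) ^ k

theorem one_sub_mul_mk_pow {R : Type*} [CommRing R] (x : R) :
    (1 - PowerSeries.C x * PowerSeries.X) * PowerSeries.mk (fun k => x ^ k) = 1 := by
  ext k
  rw [sub_mul, one_mul, mul_assoc, map_sub, PowerSeries.coeff_C_mul, PowerSeries.coeff_one]
  cases k with
  | zero => simp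
  | succ k => simp [PowerSeries.coeff_succ_X_mul, pow_succ']

theorem one_sub_mul_completeSeries_succ (n : ℕ) :
    (1 - PowerSeries.C (MvPowerSeries.X n) * PowerSeries.X) * completeSeries (n + 1) =
      completeSeries n := by
  rw [completeSeries, prod_range_succ, mul_left_comm, one_sub_mul_mk_pow, mul_one]
  rfl

/-- Base case of Jacobi–Trudi: without variables only the empty tableau survives, and the empty
shape is the one whose shifted row lengths are 0, 1, …, M. -/
theorem trunc_zero_schur {M : ℕ} {Y : YoungDiagram} (hM : Y.rowLen (M + 1) = 0) :
    trunc 0 (schur Y) = if ∀ i, beta M Y i = i then 1 else 0 := by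
  classical
  have hbot : (∀ i, beta M Y i = i) ↔ Y = ⊥ := by
    refine ⟨fun h => ?_, ?_⟩
    · have h0 : Y.rowLen 0 = 0 := by simpa [beta] using h (Fin.last M)
      rw [eq_bot_iff]
      rintro ⟨i, j⟩ hc
      have h1 := YoungDiagram.mem_iff_lt_rowLen.1 hc
      have h2 := Y.rowLen_anti 0 i (Nat.zero_le i)
      lia
    · rintro rfl i
      have : ∀ k, (⊥ : YoungDiagram).rowLen k = 0 := fun k => by
        by_contra h
        exact YoungDiagram.notMem_bot _
          (YoungDiagram.mem_iff_lt_rowLen.2 (Nat.pos_of_ne_zero h))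
      simp [beta, this]
  simp only [hbot]
  ext d
  rw [coeff_trunc, apply_ite (MvPowerSeries.coeff d), MvPowerSeries.coeff_one, map_zero]
  simp only [range_zero, subset_empty, Finsupp.support_eq_empty]
  by_cases hd : d = 0
  · subst hd
    rw [if_pos rfl, if_pos rfl, coeff_schur]
    split_ifs with hY
    · subst hY
      have : Unique {T : SemistandardYoungTableau ⊥ // content T = 0} :=
        { default := ⟨SemistandardYoungTableau.highestWeight ⊥, by simp [content]⟩
          uniq T := Subtype.ext (SemistandardYoungTableau.ext fun i j => by
            rw [T.1.zeros (YoungDiagram.notMem_bot _),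
              SemistandardYoungTableau.zeros _ (YoungDiagram.notMem_bot _)]) }
      simp
    · rw [Nat.cast_eq_zero, Nat.card_eq_zero]
      refine Or.inl ⟨fun T => hY ?_⟩
      rw [eq_bot_iff]
      rintro ⟨i, j⟩ hc
      have := mem_support_content T.1 hc
      rw [T.2] at this
      simp at this
  · simp [hd]

/-- The Jacobi–Trudi identity. -/
theorem trunc_schur {M : ℕ} (n : ℕ) {Y : YoungDiagram} (hM : Y.rowLen (M + 1) = 0) :
    trunc n (schur Y) = toeplitzMinor (completeSeries n) (beta M Y) := by
  induction n generalizing Y with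
  | zero =>
    rw [trunc_zero_schur hM, completeSeries, range_zero, prod_empty,
      toeplitzMinor_one _ (strictMono_beta M Y)]
  | succ n ih =>
    rw [trunc_succ_schur, toeplitzMinor_eq_sum (MvPowerSeries.X n) _ _ (strictMono_beta M Y),
      one_sub_mul_completeSeries_succ]
    refine sum_bij (fun Y' _ => beta M Y')
      (fun Y' hY' => beta_mem_of_interlaces (mem_interlacing.1 hY'))
      (fun Y₁ h₁ Y₂ h₂ h => beta_injOn (interlaces_rowLen_eq_zero (mem_interlacing.1 h₁) hM)
        (interlaces_rowLen_eq_zero (mem_interlacing.1 h₂) hM) h)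
      (fun s hs => ?_) (fun Y' hY' => ?_)
    · obtain ⟨Y', h, hs⟩ := exists_interlaces_beta_eq hM hs
      exact ⟨Y', mem_interlacing.2 h, hs⟩
    · have h := mem_interlacing.1 hY'
      have h0 := interlaces_rowLen_eq_zero h hM
      rw [ih h0, sum_tsub_distrib (f := beta M Y) (g := beta M Y') _ fun i _ =>
          Nat.add_le_add_right ((interlaces_iff.1 h) _).1 _,
        sum_beta hM, sum_beta h0, Nat.add_sub_add_right]

end BottomSchur

end

/-! ### Newton's identities: complete symmetric functions from power sums. -/

noncomputable section

namespace BottomSchur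

open Finset

/-- The complete homogeneous symmetric functions as polynomials in variables `z_k = p_k / k`. -/
def completePoly : ℕ → MvPolynomial ℕ ℚ
  | 0 => 1
  | n + 1 => ((n + 1 : ℚ)⁻¹) • ∑ i : Fin (n + 1),
      (((i : ℕ) + 1 : ℚ) • MvPolynomial.X ((i : ℕ) + 1)) * completePoly (n - i)
decreasing_by lia

theorem smul_completePoly_succ (n : ℕ) :
    ((n + 1 : ℚ)) • completePoly (n + 1) = ∑ i ∈ range (n + 1),
      ((i + 1 : ℚ) • MvPolynomial.X (i + 1)) * completePoly (n - i) := by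
  rw [completePoly, smul_inv_smul₀ (by positivity), ← Fin.sum_univ_eq_sum_range
    (fun i => ((i + 1 : ℚ) • MvPolynomial.X (i + 1)) * completePoly (n - i))]

/-- The logarithmic derivative of ∏ 1/(1 - x_i t) is ∑ x_i/(1 - x_i t). -/
theorem derivative_completeSeries (n : ℕ) :
    PowerSeries.derivative (MvPowerSeries ℕ ℚ) (completeSeries n) = completeSeries n *
      PowerSeries.mk fun k => ∑ i ∈ range n, (MvPowerSeries.X i : MvPowerSeries ℕ ℚ) ^ (k + 1) := by
  induction n with
  | zero =>
    have : (PowerSeries.mk fun k => ∑ i ∈ range 0,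
        (MvPowerSeries.X i : MvPowerSeries ℕ ℚ) ^ (k + 1)) = 0 := by
      ext1 k
      simp
    rw [this, mul_zero, completeSeries, range_zero, prod_empty, Derivation.map_one_eq_zero]
  | succ n ih =>
    set x : MvPowerSeries ℕ ℚ := MvPowerSeries.X n with hx
    have h1 := one_sub_mul_mk_pow x
    set g := PowerSeries.mk fun k => x ^ k with hg
    -- Differentiate (1 - x t) g = 1 and multiply by g.
    have h2 : PowerSeries.derivative (MvPowerSeries ℕ ℚ) g = g * (PowerSeries.C x * g) := by
      have h3 := congrArg (PowerSeries.derivative (MvPowerSeries ℕ ℚ)) h1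
      rw [Derivation.leibniz, Derivation.map_one_eq_zero, map_sub, Derivation.map_one_eq_zero,
        Derivation.leibniz, PowerSeries.derivative_C, PowerSeries.derivative_X] at h3
      simp only [smul_eq_mul] at h3
      linear_combination g * h3 - PowerSeries.derivative (MvPowerSeries ℕ ℚ) g * h1
    have h4 : (PowerSeries.mk fun k => ∑ i ∈ range (n + 1),
        (MvPowerSeries.X i : MvPowerSeries ℕ ℚ) ^ (k + 1)) =
        (PowerSeries.mk fun k => ∑ i ∈ range n,
          (MvPowerSeries.X i : MvPowerSeries ℕ ℚ) ^ (k + 1)) + PowerSeries.C x * g := by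
      ext1 k
      rw [map_add, PowerSeries.coeff_mk, PowerSeries.coeff_mk, PowerSeries.coeff_C_mul,
        PowerSeries.coeff_mk, sum_range_succ, pow_succ' x]
    rw [h4, completeSeries, prod_range_succ, Derivation.leibniz, h2]
    change _ • _ + _ • PowerSeries.derivative (MvPowerSeries ℕ ℚ) (completeSeries n) = _
    rw [ih, smul_eq_mul, smul_eq_mul, completeSeries]
    ring

theorem newton_completeSeries (n k : ℕ) :
    (k + 1 : ℚ) • PowerSeries.coeff (k + 1) (completeSeries n) = ∑ i ∈ range (k + 1),
      (∑ j ∈ range n, (MvPowerSeries.X j : MvPowerSeries ℕ ℚ) ^ (i + 1)) *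
        PowerSeries.coeff (k - i) (completeSeries n) := by
  have h := congrArg (PowerSeries.coeff k) (derivative_completeSeries n)
  rw [PowerSeries.coeff_derivative, mul_comm (completeSeries n), PowerSeries.coeff_mul,
    Nat.sum_antidiagonal_eq_sum_range_succ_mk] at h
  simp only [PowerSeries.coeff_mk] at h
  rw [← h, Algebra.smul_def, mul_comm]
  simp

/-- The evaluation of the variables `z_k` at `p_k / k`. -/
def evalPsum : MvPolynomial ℕ ℚ →ₐ[ℚ] MvPowerSeries ℕ ℚ :=
  MvPolynomial.aeval fun k : ℕ => (1 / (k : ℚ)) • psum k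

/-- Both sides start at 1 and obey Newton's recursion; the factor i + 1 there cancels the
denominator of z_{i+1} = p_{i+1}/(i + 1). -/
theorem trunc_evalPsum_completePoly (n k : ℕ) :
    trunc n (evalPsum (completePoly k)) = PowerSeries.coeff k (completeSeries n) := by
  induction k using Nat.strong_induction_on with
  | _ k ih =>
    cases k with
    | zero =>
      rw [completePoly, map_one, map_one, completeSeries, PowerSeries.coeff_zero_eq_constantCoeff,
        map_prod, prod_eq_one]
      intro i _
      rw [← PowerSeries.coeff_zero_eq_constantCoeff_apply, PowerSeries.coeff_mk, pow_zero]
    | succ k =>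
      have hk : (k + 1 : ℚ) ≠ 0 := by positivity
      refine smul_right_injective _ hk ?_
      dsimp only
      rw [newton_completeSeries, ← map_smul, ← map_smul, smul_completePoly_succ, map_sum, map_sum]
      refine sum_congr rfl fun i _ => ?_
      have hi : (i + 1 : ℚ) ≠ 0 := by positivity
      rw [map_mul, map_mul, ih _ (by lia), map_smul, evalPsum, MvPolynomial.aeval_X,
        smul_smul, Nat.cast_add_one, mul_one_div_cancel hi, one_smul, trunc_psum n (by lia)]

/-- The Jacobi–Trudi identity in terms of power sums. -/
theorem schur_eq {M : ℕ} {Y : YoungDiagram} (hM : Y.rowLen (M + 1) = 0) :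
    schur Y = evalPsum (toeplitzMinor (PowerSeries.mk completePoly) (beta M Y)) := by
  refine ext_of_trunc fun n => ?_
  rw [trunc_schur n hM]
  have h := map_toeplitzMinor ((trunc n).comp evalPsum).toRingHom
    (PowerSeries.mk completePoly) (beta M Y)
  refine Eq.trans ?_ h.symm
  congr 1
  ext1 k
  rw [PowerSeries.coeff_map, PowerSeries.coeff_mk]
  exact (trunc_evalPsum_completePoly n k).symm

end BottomSchur

end

/-! ### The part of lowest degree of the Jacobi–Trudi determinant. -/

noncomputable section

namespace BottomSchur

open Finset MvPolynomial

/-- The bidegree `(k, 0)` of `z_k` for `k ≠ 0`; the variable `z_0` has bidegree `(0, 1)`. -/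
def varWeight (k : ℕ) : ℕ × ℕ := (k, if k = 0 then 1 else 0)

/-- The first weight records the size of a partition. The second excludes z_0, which the first
cannot see and which would be a part equal to 0. -/
theorem isWeightedHomogeneous_completePoly (k : ℕ) :
    IsWeightedHomogeneous varWeight (completePoly k) (k, 0) := by
  induction k using Nat.strong_induction_on with
  | _ k ih =>
    cases k with
    | zero =>
      rw [completePoly]
      exact isWeightedHomogeneous_one _ _
    | succ k =>
      rw [completePoly, MvPolynomial.smul_eq_C_mul]
      refine IsWeightedHomogeneous.C_mul (IsWeightedHomogeneous.sum _ _ _ fun i _ => ?_) _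
      rw [MvPolynomial.smul_eq_C_mul]
      have h := ((isWeightedHomogeneous_X ℚ varWeight ((i : ℕ) + 1)).C_mul ((i : ℚ) + 1)).mul
        (ih (k - i) (by lia))
      convert h using 1
      ext
      · simp [varWeight]
        lia
      · simp [varWeight]

theorem isWeightedHomogeneous_toeplitzMinor {N : ℕ} (ℓ : Fin N → ℕ) {n : ℕ}
    (hn : ∑ i, ℓ i = n + ∑ i : Fin N, (i : ℕ)) :
    IsWeightedHomogeneous varWeight (toeplitzMinor (PowerSeries.mk completePoly) ℓ) (n, 0) := by
  rw [toeplitzMinor, Matrix.det_apply]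
  refine IsWeightedHomogeneous.sum _ _ _ fun σ _ => ?_
  have h : IsWeightedHomogeneous varWeight (∏ i, (Matrix.of fun i j : Fin N =>
      PowerSeries.coeff (ℓ i) (PowerSeries.X ^ (j : ℕ) * PowerSeries.mk completePoly)) (σ i) i)
      (n, 0) := by
    simp only [Matrix.of_apply, PowerSeries.coeff_X_pow_mul', PowerSeries.coeff_mk]
    by_cases hσ : ∀ i : Fin N, (i : ℕ) ≤ ℓ (σ i)
    · simp only [hσ, if_true]
      have h := IsWeightedHomogeneous.prod univ (fun i => completePoly (ℓ (σ i) - i))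
        (fun i => (ℓ (σ i) - i, 0)) (w := varWeight)
        fun i _ => isWeightedHomogeneous_completePoly _
      convert h using 1
      ext
      · rw [Prod.fst_sum, sum_tsub_distrib _ fun i _ => hσ i, Equiv.sum_comp σ ℓ, hn]
        simp
      · simp [Prod.snd_sum]
    · push Not at hσ
      obtain ⟨i, hi⟩ := hσ
      rw [prod_eq_zero (mem_univ i) (if_neg (by lia))]
      exact isWeightedHomogeneous_zero _ _ _
  rw [Units.smul_def, zsmul_eq_mul]
  have := h.C_mul ((Equiv.Perm.sign σ : ℤ) : ℚ)
  simpa using this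

theorem completePoly_mem {k : ℕ} (hk : k ≠ 0) : completePoly k ∈ idealOfVars ℕ ℚ := by
  obtain ⟨k, rfl⟩ := Nat.exists_eq_succ_of_ne_zero hk
  rw [Nat.succ_eq_add_one, completePoly]
  refine Submodule.smul_of_tower_mem _ _ (Ideal.sum_mem _ fun i _ => Ideal.mul_mem_right _ _ ?_)
  exact Submodule.smul_of_tower_mem _ _ (Ideal.subset_span ⟨_, rfl⟩)

/-- In Newton's recursion only the last summand, paired with h_0 = 1, is linear; every other one is
a variable times some h_j with j > 0. -/
theorem completePoly_sub_X_mem {k : ℕ} (hk : k ≠ 0) :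
    completePoly k - X k ∈ idealOfVars ℕ ℚ ^ 2 := by
  obtain ⟨k, rfl⟩ := Nat.exists_eq_succ_of_ne_zero hk
  have hk : (k + 1 : ℚ) ≠ 0 := by positivity
  have h : (k + 1 : ℚ) • (completePoly (k + 1) - X (k + 1)) ∈ idealOfVars ℕ ℚ ^ 2 := by
    rw [smul_sub, smul_completePoly_succ, sum_range_succ, Nat.sub_self]
    conv in completePoly 0 => rw [completePoly]
    rw [mul_one, add_sub_cancel_right]
    refine Ideal.sum_mem _ fun i hi => ?_
    rw [pow_two]
    refine Ideal.mul_mem_mul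
      (Submodule.smul_of_tower_mem _ _ (Ideal.subset_span ⟨_, rfl⟩)) (completePoly_mem ?_)
    have := mem_range.1 hi
    lia
  have h2 := Submodule.smul_of_tower_mem (idealOfVars ℕ ℚ ^ 2) ((k + 1 : ℚ)⁻¹) h
  rwa [inv_smul_smul₀ hk] at h2

section Bottom

variable {R S : Type*} [CommRing R] [CommRing S]

/-- The matrix whose determinant gives the bottom Schur function. -/
def bottomMatrix {N : ℕ} (z : ℕ → R) (ℓ : Fin N → ℕ) : Matrix (Fin N) (Fin N) R :=
  Matrix.of fun i j => if ℓ i < N then (if ℓ i = j then 1 else 0) else z (ℓ i - j)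

theorem map_det_bottomMatrix {N : ℕ} (f : R →+* S) (z : ℕ → R) (ℓ : Fin N → ℕ) :
    f (bottomMatrix z ℓ).det = (bottomMatrix (fun k => f (z k)) ℓ).det := by
  rw [RingHom.map_det]
  refine congrArg Matrix.det (Matrix.ext fun i j => ?_)
  simp only [RingHom.mapMatrix_apply, Matrix.map_apply, bottomMatrix, Matrix.of_apply]
  split_ifs <;> simp

/-- The number of rows of a Toeplitz minor that do not meet its diagonal of ones. -/
def bottomDegree {N : ℕ} (ℓ : Fin N → ℕ) : ℕ := ∑ i, if ℓ i < N then 0 else 1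

theorem prod_sub_prod_mem {ι : Type*} (I : Ideal R) (s : Finset ι) (b c : ι → R) (w : ι → ℕ)
    (hc : ∀ i ∈ s, c i ∈ I ^ w i) (hbc : ∀ i ∈ s, b i - c i ∈ I ^ (w i + 1)) :
    ∏ i ∈ s, c i ∈ I ^ (∑ i ∈ s, w i) ∧
      ∏ i ∈ s, b i - ∏ i ∈ s, c i ∈ I ^ (∑ i ∈ s, w i + 1) := by
  classical
  induction s using Finset.induction_on with
  | empty => simp
  | insert a s ha ih =>
    obtain ⟨h1, h2⟩ := ih (fun i hi => hc i (mem_insert_of_mem hi))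
      fun i hi => hbc i (mem_insert_of_mem hi)
    have h3 := hc a (mem_insert_self a s)
    have h4 := hbc a (mem_insert_self a s)
    have h5 : ∏ i ∈ s, b i ∈ I ^ (∑ i ∈ s, w i) := by
      have := Ideal.add_mem _ (Ideal.pow_le_pow_right (Nat.le_succ _) h2) h1
      rwa [sub_add_cancel] at this
    rw [prod_insert ha, prod_insert ha, sum_insert ha]
    refine ⟨pow_add I _ _ ▸ Ideal.mul_mem_mul h3 h1, ?_⟩
    have h6 : b a * ∏ i ∈ s, b i - c a * ∏ i ∈ s, c i =
        (b a - c a) * ∏ i ∈ s, b i + c a * (∏ i ∈ s, b i - ∏ i ∈ s, c i) := by ring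
    rw [h6]
    refine Ideal.add_mem _ ?_ ?_
    · rw [add_right_comm, pow_add]
      exact Ideal.mul_mem_mul h4 h5
    · rw [add_assoc, pow_add]
      exact Ideal.mul_mem_mul h3 h2

/-- Row i has order at least `w i` in the ideal, so each term of the Leibniz expansion has order at
least the sum of the weights, and an error of higher order in the entries raises the order of the
product. -/
theorem det_sub_det_mem {N : ℕ} (I : Ideal R) (B C : Matrix (Fin N) (Fin N) R) (w : Fin N → ℕ)
    (hC : ∀ i j, C i j ∈ I ^ w i) (hBC : ∀ i j, B i j - C i j ∈ I ^ (w i + 1)) :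
    B.det - C.det ∈ I ^ (∑ i, w i + 1) := by
  rw [Matrix.det_apply, Matrix.det_apply, ← sum_sub_distrib]
  refine Ideal.sum_mem _ fun σ _ => ?_
  rw [← smul_sub, Units.smul_def, zsmul_eq_mul]
  refine Ideal.mul_mem_left _ _ ?_
  have h := (prod_sub_prod_mem I univ (fun i => B (σ i) i) (fun i => C (σ i) i) (fun i => w (σ i))
    (fun i _ => hC _ _) fun i _ => hBC _ _).2
  rwa [Equiv.sum_comp σ w] at h

/-- Multiplying the Toeplitz matrix of `G` by that of a truncation of `V = G⁻¹`. -/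
theorem toeplitzMinor_eq_det {N : ℕ} (G V : PowerSeries R) (hV : PowerSeries.coeff 0 V = 1)
    (ℓ : Fin N → ℕ) :
    toeplitzMinor G ℓ = (Matrix.of fun i j : Fin N => ∑ c : Fin N,
      PowerSeries.coeff (ℓ i) (PowerSeries.X ^ (c : ℕ) * G) *
        PowerSeries.coeff c (PowerSeries.X ^ (j : ℕ) * V)).det := by
  have h : (Matrix.of fun c j : Fin N =>
      PowerSeries.coeff (c : ℕ) (PowerSeries.X ^ (j : ℕ) * V)).det = 1 := by
    rw [Matrix.det_of_isLowerTriangular]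
    · refine prod_eq_one fun i _ => ?_
      simp [PowerSeries.coeff_X_pow_mul', hV]
    · intro i j hij
      have : (i : ℕ) < j := hij
      rw [Matrix.of_apply, PowerSeries.coeff_X_pow_mul', if_neg this.not_ge]
  rw [toeplitzMinor, ← mul_one (Matrix.det _), ← h, ← Matrix.det_mul]
  rfl

/-- For l < N the cut-off at column N loses nothing: the sum is the full convolution computing the
coefficient of t^l in t^j V G = t^j. -/
theorem sum_coeff_mul_coeff_of_lt {N : ℕ} {G V : PowerSeries R} (hGV : G * V = 1) {l : ℕ}
    (hl : l < N) (j : ℕ) :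
    ∑ c : Fin N, PowerSeries.coeff l (PowerSeries.X ^ (c : ℕ) * G) *
        PowerSeries.coeff c (PowerSeries.X ^ j * V) = if l = j then 1 else 0 := by
  have h1 : PowerSeries.coeff l (PowerSeries.X ^ j * V * G) = if l = j then 1 else 0 := by
    rw [mul_assoc, mul_comm V, hGV, mul_one, PowerSeries.coeff_X_pow]
  rw [← h1, PowerSeries.coeff_mul, Nat.sum_antidiagonal_eq_sum_range_succ_mk,
    Fin.sum_univ_eq_sum_range (fun c => PowerSeries.coeff l (PowerSeries.X ^ c * G) *
        PowerSeries.coeff c (PowerSeries.X ^ j * V)) N]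
  symm
  refine sum_subset_zero_on_sdiff (range_subset_range.2 hl) (fun c hc => ?_) (fun c hc => ?_)
  · rw [mem_sdiff, mem_range, mem_range] at hc
    rw [PowerSeries.coeff_X_pow_mul', if_neg (by lia), zero_mul]
  · rw [mem_range] at hc
    rw [PowerSeries.coeff_X_pow_mul' G, if_pos (by lia), mul_comm]

end Bottom

/-- Modulo the ideal of the variables the series ∑ h_k t^k is 1, hence so is its inverse. -/
theorem exists_inverse_completePoly : ∃ V : PowerSeries (MvPolynomial ℕ ℚ),
    PowerSeries.mk completePoly * V = 1 ∧ PowerSeries.coeff 0 V = 1 ∧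
    ∀ k ≠ 0, PowerSeries.coeff k V ∈ idealOfVars ℕ ℚ := by
  have h0 : PowerSeries.constantCoeff (PowerSeries.mk completePoly) = 1 := by
    rw [← PowerSeries.coeff_zero_eq_constantCoeff_apply, PowerSeries.coeff_mk, completePoly]
  have hV := PowerSeries.mul_invOfUnit (PowerSeries.mk completePoly) 1 h0
  set V := PowerSeries.invOfUnit (PowerSeries.mk completePoly) 1
  have hmap := congrArg (PowerSeries.map (Ideal.Quotient.mk (idealOfVars ℕ ℚ))) hV
  have h1 : PowerSeries.map (Ideal.Quotient.mk (idealOfVars ℕ ℚ))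
      (PowerSeries.mk completePoly) = 1 := by
    ext1 k
    rw [PowerSeries.coeff_map, PowerSeries.coeff_mk, PowerSeries.coeff_one]
    split_ifs with hk
    · rw [hk, completePoly, map_one]
    · exact Ideal.Quotient.eq_zero_iff_mem.2 (completePoly_mem hk)
  rw [map_mul, h1, one_mul, map_one] at hmap
  refine ⟨V, hV, ?_, fun k hk => ?_⟩
  · have := congrArg PowerSeries.constantCoeff hV
    rwa [map_mul, h0, one_mul, map_one, ← PowerSeries.coeff_zero_eq_constantCoeff_apply] at this
  · have := congrArg (PowerSeries.coeff k) hmap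
    rw [PowerSeries.coeff_map, PowerSeries.coeff_one, if_neg hk] at this
    exact Ideal.Quotient.eq_zero_iff_mem.1 this

theorem toeplitzMinor_sub_det_bottomMatrix_mem {N : ℕ} (ℓ : Fin N → ℕ) :
    toeplitzMinor (PowerSeries.mk completePoly) ℓ - (bottomMatrix X ℓ).det ∈
      idealOfVars ℕ ℚ ^ (bottomDegree ℓ + 1) := by
  obtain ⟨V, hGV, hV0, hV⟩ := exists_inverse_completePoly
  rw [toeplitzMinor_eq_det _ V hV0]
  refine det_sub_det_mem _ _ _ _ (fun i j => ?_) (fun i j => ?_)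
  · rw [bottomMatrix, Matrix.of_apply]
    split_ifs with h1 h2
    · simp
    · simp
    · rw [pow_one]
      exact Ideal.subset_span ⟨_, rfl⟩
  · rw [bottomMatrix, Matrix.of_apply, Matrix.of_apply]
    split_ifs with h1 h2
    · rw [sum_coeff_mul_coeff_of_lt hGV h1, if_pos h2, sub_self]
      exact Ideal.zero_mem _
    · rw [sum_coeff_mul_coeff_of_lt hGV h1, if_neg h2, sub_self]
      exact Ideal.zero_mem _
    -- Column c = j contributes h_{ℓ_i - j}, which is z_{ℓ_i - j} modulo the square of the ideal.
    -- Any other column contributes a product of two elements of the ideal, because c < N ≤ ℓ_i.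
    · rw [← add_sum_erase _ _ (mem_univ j), add_sub_right_comm]
      have hj := j.2
      refine Ideal.add_mem _ ?_ (Ideal.sum_mem _ fun c hc => ?_)
      · rw [PowerSeries.coeff_X_pow_mul', PowerSeries.coeff_X_pow_mul', if_pos le_rfl,
          if_pos (by lia), Nat.sub_self, hV0, mul_one, PowerSeries.coeff_mk]
        exact completePoly_sub_X_mem (by lia)
      · have hc' := c.2
        have hcj : (c : ℕ) ≠ j := fun h => (mem_erase.1 hc).1 (Fin.ext h)
        rw [PowerSeries.coeff_X_pow_mul', PowerSeries.coeff_X_pow_mul', if_pos (by lia),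
          PowerSeries.coeff_mk, pow_two]
        refine Ideal.mul_mem_mul (completePoly_mem (by lia)) ?_
        split_ifs with h
        · exact hV _ (by lia)
        · exact Ideal.zero_mem _

theorem isHomogeneous_det_bottomMatrix {N : ℕ} (ℓ : Fin N → ℕ) :
    (bottomMatrix (X : ℕ → MvPolynomial ℕ ℚ) ℓ).det.IsHomogeneous (bottomDegree ℓ) := by
  rw [Matrix.det_apply]
  refine IsHomogeneous.sum _ _ _ fun σ _ => ?_
  have h := IsHomogeneous.prod univ (fun i => bottomMatrix (X : ℕ → MvPolynomial ℕ ℚ) ℓ (σ i) i)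
    (fun i => if ℓ (σ i) < N then 0 else 1) fun i _ => by
      rw [bottomMatrix, Matrix.of_apply]
      split_ifs
      · exact isHomogeneous_one _ _
      · exact isHomogeneous_zero _ _ _
      · exact isHomogeneous_X _ _
  rw [Equiv.sum_comp σ fun i => if ℓ i < N then 0 else 1] at h
  rw [Units.smul_def, zsmul_eq_mul]
  have := h.C_mul ((Equiv.Perm.sign σ : ℤ) : ℚ)
  simpa [bottomDegree] using this

theorem coeff_toeplitzMinor_of_lt {N : ℕ} (ℓ : Fin N → ℕ) {m : ℕ →₀ ℕ}
    (hm : m.degree < bottomDegree ℓ) :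
    coeff m (toeplitzMinor (PowerSeries.mk completePoly) ℓ) = 0 := by
  have h := (mem_pow_idealOfVars_iff' _ _).1 (toeplitzMinor_sub_det_bottomMatrix_mem ℓ) m (by lia)
  rw [coeff_sub, (isHomogeneous_det_bottomMatrix ℓ).coeff_eq_zero hm.ne, sub_zero] at h
  exact h

theorem coeff_toeplitzMinor_of_eq {N : ℕ} (ℓ : Fin N → ℕ) {m : ℕ →₀ ℕ}
    (hm : m.degree = bottomDegree ℓ) :
    coeff m (toeplitzMinor (PowerSeries.mk completePoly) ℓ) =
      coeff m (bottomMatrix X ℓ).det := by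
  have h := (mem_pow_idealOfVars_iff' _ _).1 (toeplitzMinor_sub_det_bottomMatrix_mem ℓ) m (by lia)
  rwa [coeff_sub, sub_eq_zero] at h

/-- Clearing denominators gives a polynomial of degree less than #J. If all the sums vanished it
would have at least #J roots and be zero, yet its value at j ∈ J is v_j ∏ (j - k) ≠ 0. -/
theorem sum_div_sub_ne_zero {ι : Type*} {J : Finset ℚ} {s : Finset ι} {v : ℚ → ℚ} {a : ι → ℚ}
    (ha : Set.InjOn a s) (hJ : J.Nonempty) (hv : ∀ j ∈ J, v j ≠ 0) (haJ : ∀ i ∈ s, a i ∉ J)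
    (hcard : #J ≤ #s) : ∃ i ∈ s, ∑ j ∈ J, v j / (a i - j) ≠ 0 := by
  by_contra! h
  let p : Polynomial ℚ := ∑ j ∈ J, Polynomial.C (v j) * ∏ k ∈ J.erase j,
    (Polynomial.X - Polynomial.C k)
  have hp : p = 0 := by
    refine Polynomial.eq_zero_of_degree_lt_of_eval_index_eq_zero s ha ?_ fun i hi => ?_
    · refine (Polynomial.degree_sum_le _ _).trans_lt ?_
      rw [Finset.sup_lt_iff (WithBot.bot_lt_coe _)]
      intro j hj
      rw [Polynomial.degree_C_mul (hv j hj), Polynomial.degree_prod,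
        sum_congr rfl fun k _ => Polynomial.degree_X_sub_C k,
        sum_const, card_erase_of_mem hj, nsmul_one]
      have : #J - 1 < #s := by
        have := hJ.card_pos
        lia
      exact_mod_cast this
    · have h1 : (∏ k ∈ J, (a i - k)) * ∑ j ∈ J, v j / (a i - j) = 0 := by rw [h i hi, mul_zero]
      rw [mul_sum] at h1
      rw [← h1, Polynomial.eval_finsetSum]
      refine sum_congr rfl fun j hj => ?_
      have hne : a i - j ≠ 0 := fun h0 => haJ i hi (by rwa [sub_eq_zero.1 h0])
      rw [← mul_prod_erase _ _ hj]
      simp only [Polynomial.eval_mul, Polynomial.eval_C, Polynomial.eval_prod,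
        Polynomial.eval_sub, Polynomial.eval_X]
      field_simp
  obtain ⟨j, hj⟩ := hJ
  have h2 := congrArg (Polynomial.eval j) hp
  rw [Polynomial.eval_finsetSum, sum_eq_single j] at h2
  · simp only [Polynomial.eval_mul, Polynomial.eval_C, Polynomial.eval_prod,
        Polynomial.eval_sub, Polynomial.eval_X, Polynomial.eval_zero, mul_eq_zero,
        prod_eq_zero_iff, sub_eq_zero] at h2
    rcases h2 with h2 | ⟨k, hk, rfl⟩
    · exact hv j hj h2
    · simp at hk
  · intro k _ hkj
    rw [Polynomial.eval_mul, Polynomial.eval_prod, prod_eq_zero (mem_erase.2 ⟨hkj.symm, hj⟩),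
      mul_zero]
    simp
  · exact fun h' => absurd hj h'

/-- Specialize z_k = 1/k and take a kernel vector v. The unit rows force v to vanish at each ℓ_i <
N, so its support has no more elements than there are remaining rows. Those rows say that ∑ v_j/(ℓ_i
- j) = 0, contradicting the Cauchy-type lemma. -/
theorem det_bottomMatrix_ne_zero {N : ℕ} {ℓ : Fin N → ℕ} (hℓ : Function.Injective ℓ) :
    (bottomMatrix (X : ℕ → MvPolynomial ℕ ℚ) ℓ).det ≠ 0 := by
  classical
  intro h0
  have h1 := congrArg (aeval (R := ℚ) fun k : ℕ => (1 / k : ℚ)).toRingHom h0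
  rw [map_det_bottomMatrix, map_zero] at h1
  obtain ⟨v, hv, hmul⟩ := Matrix.exists_mulVec_eq_zero_iff.2 h1
  have hrow := fun i => congrFun hmul i
  simp only [Matrix.mulVec, dotProduct, bottomMatrix, Matrix.of_apply, AlgHom.toRingHom_eq_coe,
    RingHom.coe_coe, aeval_X, Pi.zero_apply] at hrow
  have hsmall : ∀ i (hi : ℓ i < N), v ⟨ℓ i, hi⟩ = 0 := by
    intro i hi
    have := hrow i
    simp only [hi, if_true] at this
    rw [sum_eq_single ⟨ℓ i, hi⟩] at this
    · simpa using this
    · intro j _ hj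
      rw [if_neg fun h => hj (Fin.ext h.symm), zero_mul]
    · simp
  let J : Finset (Fin N) := {j | v j ≠ 0}
  let s : Finset (Fin N) := {i | ¬ ℓ i < N}
  have hJ : J.Nonempty := by
    obtain ⟨j, hj⟩ := Function.ne_iff.1 hv
    exact ⟨j, by simpa [J] using hj⟩
  have hcard : #J ≤ #s := by
    have h2 : #{i : Fin N | ℓ i < N} ≤ #{j | ¬ v j ≠ 0} := by
      refine card_le_card_of_injOn (fun i => if h : ℓ i < N then ⟨ℓ i, h⟩ else i) ?_ ?_
      · intro i hi
        have hi' : ℓ i < N := by simpa using hi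
        simp [hi', hsmall]
      · intro i hi j hj hij
        have hi' : ℓ i < N := by simpa using hi
        have hj' : ℓ j < N := by simpa using hj
        simp only [hi', hj', dif_pos, Fin.mk.injEq] at hij
        exact hℓ hij
    have h3 := card_filter_add_card_filter_not (s := univ) (fun j => v j ≠ 0)
    have h4 := card_filter_add_card_filter_not (s := univ) (fun i : Fin N => ℓ i < N)
    lia
  have hcast : Function.Injective fun j : Fin N => ((j : ℕ) : ℚ) :=
    fun i j hij => Fin.ext (Nat.cast_injective hij)
  let e : Fin N ↪ ℚ := ⟨_, hcast⟩
  -- The vector v is carried from indices to rational numbers; the value 0 elsewhere plays no role,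
  -- as only points of J enter.
  obtain ⟨i, hi, hne⟩ := sum_div_sub_ne_zero (J := J.map e) (s := s)
    (v := Function.extend e v 0) (a := fun i => (ℓ i : ℚ))
    (fun i _ j _ hij => hℓ (Nat.cast_injective hij)) (hJ.map)
    (by
      intro j hj
      obtain ⟨j, hj, rfl⟩ := mem_map.1 hj
      rw [e.injective.extend_apply]
      simpa [J] using hj)
    (by
      intro i hi hmem
      obtain ⟨j, hj, hij⟩ := mem_map.1 hmem
      have hij' : (j : ℕ) = ℓ i := Nat.cast_injective hij
      have hi' : ¬ ℓ i < N := by simpa [s] using hi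
      exact hi' (hij' ▸ j.2))
    (by rwa [card_map])
  apply hne
  have hi' : ¬ ℓ i < N := by simpa [s] using hi
  have hrow' := hrow i
  simp only [hi', if_false] at hrow'
  rw [sum_map, ← hrow']
  refine sum_subset_zero_on_sdiff (subset_univ _) (fun j hj => ?_) fun j _ => ?_
  · have : v j = 0 := by simpa [J] using hj
    rw [this, mul_zero]
  · rw [e.injective.extend_apply, Nat.cast_sub (by have := j.2; lia)]
    change v j / ((ℓ i : ℚ) - (j : ℕ)) = _
    ring

end BottomSchur

end

/-! ### Monomial expansions of power sum products and augmented monomials. -/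

noncomputable section

namespace BottomSchur

open Finset

/-- Equal multisets of values mean fibres of equal size, and bijections between the fibres glue. -/
theorem exists_equiv_of_map_univ_eq {α β : Type*} [Fintype α] [Fintype β] {f : α → ℕ} {g : β → ℕ}
    (h : (univ : Finset α).val.map f = (univ : Finset β).val.map g) :
    ∃ e : α ≃ β, ∀ a, g (e a) = f a := by
  classical
  have hcard : ∀ v, Fintype.card {a // f a = v} = Fintype.card {b // g b = v} := by
    intro v
    have := congrArg (Multiset.count v) h
    rw [Multiset.count_map, Multiset.count_map, ← Finset.filter_val, ← Finset.filter_val] at this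
    rw [Fintype.card_subtype, Fintype.card_subtype, card_def, card_def]
    simpa only [eq_comm] using this
  exact ⟨Equiv.ofFiberEquiv fun v => Fintype.equivOfCardEq (hcard v),
    fun a => Equiv.ofFiberEquiv_map _ a⟩

theorem map_univ_support (d : ℕ →₀ ℕ) :
    (univ : Finset d.support).val.map (fun x : d.support => d x.1) = d.support.val.map d := by
  rw [univ_eq_attach, attach_val]
  exact Multiset.attach_map_val' d.support.val d

section Exponent

variable {ι : Type*} [Fintype ι]

/-- The exponent vector of the monomial `∏ i, x_{f i} ^ k i`. -/
def exponent (k f : ι → ℕ) : ℕ →₀ ℕ := ∑ i, Finsupp.single (f i) (k i)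

theorem exponent_apply (k f : ι → ℕ) (x : ℕ) [DecidablePred fun i => f i = x] :
    exponent k f x = ∑ i with f i = x, k i := by
  rw [exponent, Finsupp.finsetSum_apply, sum_filter]
  exact sum_congr rfl fun i _ => by simp [Finsupp.single_apply]

theorem support_exponent {k : ι → ℕ} (hk : ∀ i, k i ≠ 0) (f : ι → ℕ) :
    (exponent k f).support = univ.image f := by
  classical
  ext x
  rw [Finsupp.mem_support_iff, exponent_apply, Ne, sum_eq_zero_iff]
  simp [hk]

theorem exponent_apply_of_injective {k f : ι → ℕ} (hf : Function.Injective f) (i : ι) :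
    exponent k f (f i) = k i := by
  classical
  rw [exponent_apply, sum_filter]
  simp [hf.eq_iff]

theorem exponent_eq_iff {k f : ι → ℕ} (hk : ∀ i, k i ≠ 0) (hf : Function.Injective f)
    {d : ℕ →₀ ℕ} : exponent k f = d ↔ d.support = univ.image f ∧ ∀ i, d (f i) = k i := by
  constructor
  · rintro rfl
    exact ⟨support_exponent hk f, exponent_apply_of_injective hf⟩
  · rintro ⟨h1, h2⟩
    ext x
    by_cases hx : x ∈ univ.image f
    · obtain ⟨i, -, rfl⟩ := mem_image.1 hx
      rw [exponent_apply_of_injective hf, h2]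
    · rw [Finsupp.notMem_support_iff.1 (by rwa [support_exponent hk]),
        Finsupp.notMem_support_iff.1 (by rwa [h1])]

theorem map_support_exponent {k f : ι → ℕ} (hk : ∀ i, k i ≠ 0) (hf : Function.Injective f) :
    (exponent k f).support.val.map (exponent k f) = (univ : Finset ι).val.map k := by
  classical
  rw [support_exponent hk, image_val_of_injOn hf.injOn, Multiset.map_map]
  exact Multiset.map_congr rfl fun i _ => exponent_apply_of_injective hf i

theorem exists_exponent_eq {k : ι → ℕ} (hk : ∀ i, k i ≠ 0) {d : ℕ →₀ ℕ}
    (h : d.support.val.map d = (univ : Finset ι).val.map k) :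
    ∃ f : ι → ℕ, Function.Injective f ∧ exponent k f = d := by
  classical
  rw [← map_univ_support] at h
  obtain ⟨e, he⟩ := exists_equiv_of_map_univ_eq h.symm
  have hf : Function.Injective fun i => (e i : ℕ) := Subtype.val_injective.comp e.injective
  refine ⟨fun i => e i, hf, (exponent_eq_iff hk hf).2 ⟨?_, he⟩⟩
  ext x
  rw [mem_image]
  refine ⟨fun hx => ⟨e.symm ⟨x, hx⟩, mem_univ _, by simp⟩, ?_⟩
  rintro ⟨i, -, rfl⟩
  exact (e i).2

theorem injective_of_card_support_exponent {k : ι → ℕ} (hk : ∀ i, k i ≠ 0) {f : ι → ℕ}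
    (h : Fintype.card ι ≤ #(exponent k f).support) : Function.Injective f := by
  classical
  rw [support_exponent hk] at h
  exact Set.injOn_univ.1 (coe_univ (α := ι) ▸ card_image_iff.1 (le_antisymm card_image_le h))

theorem monomial_exponent (k f : ι → ℕ) :
    MvPowerSeries.monomial (exponent k f) (1 : ℚ) = ∏ i, MvPowerSeries.X (f i) ^ k i := by
  simp only [MvPowerSeries.X_pow_eq]
  rw [MvPowerSeries.prod_monomial, prod_const_one]
  rfl

variable [DecidableEq ι]

theorem trunc_prod_psum {k : ι → ℕ} (hk : ∀ i, k i ≠ 0) (n : ℕ) :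
    trunc n (∏ i, psum (k i)) = ∑ f ∈ Fintype.piFinset fun _ : ι => range n,
      MvPowerSeries.monomial (exponent k f) 1 := by
  rw [map_prod]
  simp only [trunc_psum n (hk _)]
  rw [prod_univ_sum]
  exact sum_congr rfl fun f _ => (monomial_exponent k f).symm

theorem coeff_prod_psum {k : ι → ℕ} (hk : ∀ i, k i ≠ 0) {n : ℕ} {d : ℕ →₀ ℕ}
    (hd : d.support ⊆ range n) :
    MvPowerSeries.coeff d (∏ i, psum (k i)) =
      #{f ∈ Fintype.piFinset fun _ : ι => range n | exponent k f = d} := by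
  classical
  have h := congrArg (MvPowerSeries.coeff d) (trunc_prod_psum hk n)
  rw [coeff_trunc, if_pos hd, map_sum] at h
  rw [h, card_filter, Nat.cast_sum]
  refine sum_congr rfl fun f _ => ?_
  rw [MvPowerSeries.coeff_monomial]
  simp [eq_comm]

theorem mem_piFinset_range_of_exponent {k : ι → ℕ} (hk : ∀ i, k i ≠ 0) {n : ℕ} {f : ι → ℕ}
    (hd : (exponent k f).support ⊆ range n) : f ∈ Fintype.piFinset fun _ : ι => range n := by
  rw [support_exponent hk] at hd
  exact Fintype.mem_piFinset.2 fun i => hd (mem_image_of_mem f (mem_univ i))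

theorem coeff_prod_psum_ne_zero {k : ι → ℕ} (hk : ∀ i, k i ≠ 0) {d : ℕ →₀ ℕ}
    (h : d.support.val.map d = (univ : Finset ι).val.map k) :
    MvPowerSeries.coeff d (∏ i, psum (k i)) ≠ 0 := by
  obtain ⟨n, hn⟩ := d.support.exists_nat_subset_range
  obtain ⟨f, -, hf⟩ := exists_exponent_eq hk h
  rw [coeff_prod_psum hk hn, Nat.cast_ne_zero, card_ne_zero]
  exact ⟨f, mem_filter.2 ⟨mem_piFinset_range_of_exponent hk (hf ▸ hn), hf⟩⟩

theorem exists_of_coeff_prod_psum_ne_zero {k : ι → ℕ} (hk : ∀ i, k i ≠ 0) {d : ℕ →₀ ℕ}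
    (h : MvPowerSeries.coeff d (∏ i, psum (k i)) ≠ 0) : ∃ f, exponent k f = d := by
  obtain ⟨n, hn⟩ := d.support.exists_nat_subset_range
  rw [coeff_prod_psum hk hn, Nat.cast_ne_zero, card_ne_zero] at h
  obtain ⟨f, hf⟩ := h
  exact ⟨f, (mem_filter.1 hf).2⟩

/-- The number of injective `f` such that `∏ i, x_{f i} ^ k i` is a given monomial. -/
theorem card_injective_exponent_eq {k : ι → ℕ} (hk : ∀ i, k i ≠ 0) {n : ℕ} {d : ℕ →₀ ℕ}
    (hd : d.support ⊆ range n) (h : d.support.val.map d = (univ : Finset ι).val.map k) :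
    #{f ∈ Fintype.piFinset fun _ : ι => range n | Function.Injective f ∧ exponent k f = d} =
      ∏ v ∈ univ.image k, (Fintype.card {i // k i = v}).factorial := by
  obtain ⟨f₀, hf₀, h₀⟩ := exists_exponent_eq hk h
  -- Any two injective f with the same monomial differ by a permutation preserving k, so they are
  -- counted by the stabilizer of k.
  rw [← DomMulAct.stabilizer_card' k, Fintype.card_subtype]
  symm
  refine card_bij (fun σ _ => f₀ ∘ σ) (fun σ hσ => ?_) (fun σ _ τ _ hστ => ?_) fun f hf => ?_
  · have hσ' : k ∘ σ = k := by simpa using hσ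
    have hinj : Function.Injective (f₀ ∘ σ) := hf₀.comp σ.injective
    have hexp : exponent k (f₀ ∘ σ) = d := by
      rw [← h₀, exponent, exponent, ← Equiv.sum_comp σ fun i => Finsupp.single (f₀ i) (k i)]
      exact sum_congr rfl fun i _ => by rw [← congrFun hσ' i]; rfl
    exact mem_filter.2 ⟨mem_piFinset_range_of_exponent hk (hexp ▸ hd), hinj, hexp⟩
  · exact Equiv.ext fun i => hf₀ (congrFun hστ i)
  · obtain ⟨-, hinj, hexp⟩ := mem_filter.1 hf
    rw [exponent_eq_iff hk hf₀] at h₀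
    rw [exponent_eq_iff hk hinj] at hexp
    have hex : ∀ i, ∃ j, f₀ j = f i := fun i => by
      have : f i ∈ univ.image f₀ := by
        rw [← h₀.1, hexp.1]
        exact mem_image_of_mem f (mem_univ i)
      simpa using this
    choose σ hσ using hex
    have hσinj : Function.Injective σ := fun i j hij => hinj (by rw [← hσ i, ← hσ j, hij])
    refine ⟨Equiv.ofBijective σ (Finite.injective_iff_bijective.1 hσinj), ?_, funext hσ⟩
    refine mem_filter.2 ⟨mem_univ _, funext fun i => ?_⟩
    change k (σ i) = k i
    rw [← h₀.2, hσ, hexp.2]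

end Exponent

/-- The augmented monomial symmetric function of a multiset of positive integers. -/
def augMonomial (s : Multiset ℕ) : MvPowerSeries ℕ ℚ :=
  fun d => if d.support.val.map d = s then
    ((∏ i ∈ s.toFinset, (s.count i).factorial : ℕ) : ℚ) else 0

theorem coeff_augMonomial (s : Multiset ℕ) (d : ℕ →₀ ℕ) :
    MvPowerSeries.coeff d (augMonomial s) = if d.support.val.map d = s then
      ((∏ i ∈ s.toFinset, (s.count i).factorial : ℕ) : ℚ) else 0 := rfl

theorem augMsymm_eq {n : ℕ} (μ : n.Partition) : augMsymm μ = augMonomial μ.parts := by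
  ext d
  rw [coeff_augMonomial, augMsymm, MvPowerSeries.coeff_smul]
  change _ * (if d.support.val.map d = μ.parts then (1 : ℚ) else 0) = _
  rw [mul_ite, mul_one, mul_zero]

/-- The factor ∏ m_i(μ)! is the number of injective f giving one and the same monomial, so m̃_μ is
the part of the expansion of p_μ indexed by injective f. -/
theorem trunc_augMonomial {ι : Type*} [Fintype ι] [DecidableEq ι] {k : ι → ℕ}
    (hk : ∀ i, k i ≠ 0) (n : ℕ) :
    trunc n (augMonomial ((univ : Finset ι).val.map k)) =
      ∑ f ∈ Fintype.piFinset fun _ : ι => range n with Function.Injective f,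
        MvPowerSeries.monomial (exponent k f) 1 := by
  classical
  ext d
  rw [coeff_trunc, coeff_augMonomial, map_sum]
  have h1 : ∑ f ∈ Fintype.piFinset fun _ : ι => range n with Function.Injective f,
      MvPowerSeries.coeff d (MvPowerSeries.monomial (exponent k f) (1 : ℚ)) =
      #{f ∈ Fintype.piFinset fun _ : ι => range n | Function.Injective f ∧ exponent k f = d} := by
    rw [← filter_filter, card_filter, Nat.cast_sum]
    refine sum_congr rfl fun f _ => ?_
    rw [MvPowerSeries.coeff_monomial]
    simp [eq_comm]
  rw [h1]
  split_ifs with hd h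
  · rw [card_injective_exponent_eq hk hd h]
    refine congrArg Nat.cast (prod_congr rfl fun v _ => ?_)
    rw [Multiset.count_map, Fintype.card_subtype, card_def, filter_val]
    simp only [eq_comm]
  · symm
    rw [Nat.cast_eq_zero, card_eq_zero, filter_eq_empty_iff]
    rintro f - ⟨hinj, rfl⟩
    exact h (map_support_exponent hk hinj)
  · symm
    rw [Nat.cast_eq_zero, card_eq_zero, filter_eq_empty_iff]
    rintro f hf ⟨hinj, rfl⟩
    apply hd
    rw [support_exponent hk]
    intro x hx
    obtain ⟨i, -, rfl⟩ := mem_image.1 hx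
    exact Fintype.mem_piFinset.1 hf i

theorem exists_fin_map_eq (s : Multiset ℕ) :
    ∃ k : Fin (Multiset.card s) → ℕ, (univ : Finset (Fin (Multiset.card s))).val.map k = s := by
  induction s using Quotient.inductionOn with
  | _ l =>
    exact ⟨l.get, (Fin.univ_val_map l.get).trans (congrArg _ (List.ofFn_get l))⟩

/-- Triangularity by length: among the partitions in a relation take μ with the most parts and look
at the coefficient of x^μ. A product p_ν containing x^μ arises from an assignment of variables that
hits ℓ(μ) ≥ ℓ(ν) of them, so the assignment is injective and ν = μ. -/
theorem linearIndependent_psumPart (n : ℕ) :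
    LinearIndependent ℚ (psumPart : n.Partition → MvPowerSeries ℕ ℚ) := by
  classical
  rw [Fintype.linearIndependent_iff]
  intro a ha
  by_contra! hne
  obtain ⟨μ, hμ, hmax⟩ := exists_max_image {μ | a μ ≠ 0} (fun μ : n.Partition =>
    Multiset.card μ.parts) (by obtain ⟨i, hi⟩ := hne; exact ⟨i, by simpa using hi⟩)
  have hpos : ∀ ν : n.Partition, ∃ k : Fin (Multiset.card ν.parts) → ℕ,
      (univ : Finset (Fin (Multiset.card ν.parts))).val.map k = ν.parts ∧ ∀ i, k i ≠ 0 := by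
    intro ν
    obtain ⟨k, hk⟩ := exists_fin_map_eq ν.parts
    refine ⟨k, hk, fun i => (ν.parts_pos (hk ▸ Multiset.mem_map_of_mem k (mem_univ i))).ne'⟩
  have hp : ∀ (ν : n.Partition) (k : Fin (Multiset.card ν.parts) → ℕ),
      (univ : Finset (Fin (Multiset.card ν.parts))).val.map k = ν.parts →
      psumPart ν = ∏ i, psum (k i) := by
    intro ν k hk
    have h := congrArg (fun s => (Multiset.map psum s).prod) hk
    rw [Multiset.map_map] at h
    exact h.symm
  obtain ⟨k, hk, hk0⟩ := hpos μ
  set d := exponent k fun i => (i : ℕ) with hd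
  have hdμ : d.support.val.map d = μ.parts := by
    rw [hd, map_support_exponent hk0 Fin.val_injective, hk]
  have hcoeff := congrArg (MvPowerSeries.coeff d) ha
  rw [map_sum, sum_eq_single μ] at hcoeff
  · rw [MvPowerSeries.coeff_smul, hp μ k hk, map_zero, mul_eq_zero] at hcoeff
    rcases hcoeff with h | h
    · simp [h] at hμ
    · exact coeff_prod_psum_ne_zero hk0 (hdμ.trans hk.symm) h
  · intro ν _ hν
    rw [MvPowerSeries.coeff_smul]
    by_contra h
    obtain ⟨h1, h2⟩ := mul_ne_zero_iff.1 h
    obtain ⟨k', hk', hk0'⟩ := hpos ν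
    rw [hp ν k' hk'] at h2
    obtain ⟨f, hf⟩ := exists_of_coeff_prod_psum_ne_zero hk0' h2
    have hcard : #d.support = Multiset.card μ.parts := by
      rw [← hdμ, Multiset.card_map]
      rfl
    have h3 := hmax ν (by simpa using h1)
    have hinj : Function.Injective f := injective_of_card_support_exponent hk0' (by
      rw [hf, hcard, Fintype.card_fin]
      exact h3)
    have h4 := map_support_exponent hk0' hinj
    rw [hf, hdμ, hk'] at h4
    exact hν (Nat.Partition.ext h4.symm)
  · simp

end BottomSchur

end

/-! ### From power sums to augmented monomials, and the theorem. -/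

noncomputable section

namespace BottomSchur

open Finset MvPolynomial

/-- The evaluation of the variables `z_k` at `p_k`. -/
def psumHom : MvPolynomial ℕ ℚ →ₐ[ℚ] MvPowerSeries ℕ ℚ := aeval psum

/-- The linear map that sends the monomial with variables `z_k`, `k ∈ s`, to the augmented monomial
symmetric function of `s`. -/
def augMap : MvPolynomial ℕ ℚ →ₗ[ℚ] MvPowerSeries ℕ ℚ :=
  (basisMonomials ℕ ℚ).constr ℚ fun m => augMonomial (Finsupp.toMultiset m)

theorem augMap_monomial (m : ℕ →₀ ℕ) :
    augMap (monomial m 1) = augMonomial (Finsupp.toMultiset m) := by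
  have h := (basisMonomials ℕ ℚ).constr_basis ℚ (fun m => augMonomial (Finsupp.toMultiset m)) m
  rwa [coe_basisMonomials] at h

theorem augMap_prod_X {ι : Type*} [Fintype ι] (k : ι → ℕ) :
    augMap (∏ i, X (k i)) = augMonomial ((univ : Finset ι).val.map k) := by
  have h : (∏ i, X (k i) : MvPolynomial ℕ ℚ) = monomial (∑ i, Finsupp.single (k i) 1) 1 := by
    rw [monomial_sum_one]
    rfl
  rw [h, augMap_monomial, map_sum]
  simp only [Finsupp.toMultiset_single, one_smul]
  congr 1
  rw [Finset.sum, ← Multiset.sum_map_singleton ((univ : Finset ι).val.map k), Multiset.map_map]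
  rfl

theorem prod_ite_eq_ite_prod {R : Type*} [CommRing R] {N : ℕ} (ℓ : Fin N → ℕ)
    (σ : Equiv.Perm (Fin N)) (w : Fin N → R) :
    (∏ i, if ℓ i < N then (if ℓ i = σ i then 1 else 0) else w i) =
      if ∀ i, ℓ i < N → ℓ i = σ i then ∏ i : {i // ¬ ℓ i < N}, w i else 0 := by
  split_ifs with h
  · rw [← Fintype.prod_subtype_mul_prod_subtype fun i => ℓ i < N, prod_eq_one, one_mul]
    · exact prod_congr rfl fun i _ => if_neg i.2
    · intro i _
      rw [if_pos i.2, if_pos (h i i.2)]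
  · push Not at h
    obtain ⟨i, h1, h2⟩ := h
    exact prod_eq_zero (mem_univ i) (by rw [if_pos h1, if_neg h2])

/-- One Leibniz expansion serves both for entries z_{ℓ_i - j} and for entries x_i^{ℓ_i - j}, so the
two can be compared permutation by permutation. -/
theorem det_of_ite {R : Type*} [CommRing R] {N : ℕ} (ℓ : Fin N → ℕ) (w : Fin N → Fin N → R) :
    (Matrix.of fun i j : Fin N => if ℓ i < N then (if ℓ i = (j : ℕ) then 1 else 0) else w i j).det =
      ∑ σ : Equiv.Perm (Fin N), ((Equiv.Perm.sign σ : ℤ) : R) *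
        if ∀ i, ℓ i < N → ℓ i = σ i then ∏ i : {i // ¬ ℓ i < N}, w i (σ i) else 0 := by
  rw [← Matrix.det_transpose, Matrix.det_apply']
  refine sum_congr rfl fun σ _ => ?_
  rw [← prod_ite_eq_ite_prod ℓ σ fun i => w i (σ i)]
  rfl

/-- With ℓ_a ≤ ℓ_b and a common variable x, row b is x^{ℓ_b - ℓ_a} times row a; the exponents are
genuine differences because ℓ_a ≥ N > j. -/
theorem det_pow_eq_zero {R : Type*} [CommRing R] {N : ℕ} (ℓ : Fin N → ℕ) (x : Fin N → R)
    {a b : Fin N} (hab : a ≠ b) (ha : ¬ ℓ a < N) (hb : ¬ ℓ b < N) (hx : x a = x b) :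
    (Matrix.of fun i j : Fin N => if ℓ i < N then (if ℓ i = (j : ℕ) then 1 else 0) else
      x i ^ (ℓ i - j)).det = 0 := by
  wlog hle : ℓ a ≤ ℓ b generalizing a b
  · exact this hab.symm hb ha hx.symm (le_of_not_ge hle)
  set A := (Matrix.of fun i j : Fin N => if ℓ i < N then (if ℓ i = (j : ℕ) then 1 else 0) else
      x i ^ (ℓ i - j)) with hA
  have h : A = A.updateRow b (x a ^ (ℓ b - ℓ a) • A a) := by
    have hrow : x a ^ (ℓ b - ℓ a) • A a = A b := by
      funext j
      have hj := j.2
      simp only [hA, Pi.smul_apply, Matrix.of_apply, if_neg ha, if_neg hb, smul_eq_mul, ← hx,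
        ← pow_add]
      congr 1
      lia
    rw [hrow, Matrix.updateRow_eq_self]
  rw [h, Matrix.det_updateRow_smul, Matrix.det_updateRow_eq_zero hab, mul_zero]

/-- The heart of the theorem. In n variables both sides are sums over assignments f of variables to
the rows with ℓ_i ≥ N, over all f on the left and over injective f on the right. For fixed
non-injective f the signed sum over permutations is a determinant with two proportional rows. -/
theorem psumHom_det_bottomMatrix {N : ℕ} (ℓ : Fin N → ℕ) :
    psumHom (bottomMatrix X ℓ).det = augMap (bottomMatrix X ℓ).det := by
  classical
  refine ext_of_trunc fun n => ?_
  have hk : ∀ σ : Equiv.Perm (Fin N), ∀ i : {i // ¬ ℓ i < N}, ℓ i - σ i ≠ 0 := fun σ i => by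
    have h1 := i.2
    have h2 := (σ i).2
    lia
  let mon (σ : Equiv.Perm (Fin N)) (f : {i // ¬ ℓ i < N} → ℕ) : MvPowerSeries ℕ ℚ :=
    ((Equiv.Perm.sign σ : ℤ) : ℚ) • if ∀ i, ℓ i < N → ℓ i = σ i then
      MvPowerSeries.monomial (exponent (fun i : {i // ¬ ℓ i < N} => ℓ i - σ i) f) 1 else 0
  have hdet : (bottomMatrix X ℓ).det = ∑ σ : Equiv.Perm (Fin N), ((Equiv.Perm.sign σ : ℤ) : ℚ) •
      if ∀ i, ℓ i < N → ℓ i = σ i then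
        ∏ i : {i // ¬ ℓ i < N}, (X (ℓ i - σ i) : MvPolynomial ℕ ℚ) else 0 := by
    refine (det_of_ite ℓ fun i j => X (ℓ i - j)).trans (sum_congr rfl fun σ _ => ?_)
    rw [Algebra.smul_def, map_intCast]
  have hp : trunc n (psumHom (bottomMatrix X ℓ).det) =
      ∑ f ∈ Fintype.piFinset fun _ => range n, ∑ σ, mon σ f := by
    rw [sum_comm, hdet, map_sum, map_sum]
    refine sum_congr rfl fun σ _ => ?_
    rw [map_smul, map_smul, ← smul_sum]
    congr 1
    split_ifs
    · rw [map_prod]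
      simp only [psumHom, aeval_X]
      exact trunc_prod_psum (hk σ) n
    · simp
  have hm : trunc n (augMap (bottomMatrix X ℓ).det) =
      ∑ f ∈ Fintype.piFinset fun _ => range n with Function.Injective f, ∑ σ, mon σ f := by
    rw [sum_comm, hdet, map_sum, map_sum]
    refine sum_congr rfl fun σ _ => ?_
    rw [map_smul, map_smul, ← smul_sum]
    congr 1
    split_ifs
    · rw [augMap_prod_X]
      exact trunc_augMonomial (hk σ) n
    · simp
  rw [hp, hm, ← sum_filter_add_sum_filter_not _ fun f => Function.Injective f, add_eq_left]
  refine sum_eq_zero fun f hf => ?_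
  obtain ⟨a, b, hfab, hab⟩ := Function.not_injective_iff.1 (mem_filter.1 hf).2
  let x : Fin N → MvPowerSeries ℕ ℚ := fun i =>
    if h : ¬ ℓ i < N then MvPowerSeries.X (f ⟨i, h⟩) else 0
  have hx : ∀ i : {i // ¬ ℓ i < N}, x i = MvPowerSeries.X (f i) := fun i => dif_pos i.2
  have h0 := det_pow_eq_zero ℓ x (Subtype.coe_ne_coe.2 hab) a.2 b.2 (by rw [hx, hx, hfab])
  rw [det_of_ite ℓ fun i j => x i ^ (ℓ i - j)] at h0
  rw [← h0]
  refine sum_congr rfl fun σ _ => ?_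
  simp only [mon, monomial_exponent, hx]
  rw [Algebra.smul_def, map_intCast]

theorem toFinsupp_parts_injective (n : ℕ) :
    Function.Injective fun μ : n.Partition => Multiset.toFinsupp μ.parts := fun _ _ h =>
  Nat.Partition.ext (Multiset.toFinsupp.injective h)

/-- Weight (n, 0) means that the indices of the monomial sum to n and that z_0 is absent, so they
are the parts of a partition of n. -/
theorem exists_partition_of_coeff_ne_zero {F : MvPolynomial ℕ ℚ} {n : ℕ}
    (hF : IsWeightedHomogeneous varWeight F (n, 0)) {m : ℕ →₀ ℕ} (hm : coeff m F ≠ 0) :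
    ∃ μ : n.Partition, Multiset.toFinsupp μ.parts = m := by
  have h := hF hm
  rw [Finsupp.weight_apply, Finsupp.sum, Prod.ext_iff, Prod.fst_sum, Prod.snd_sum,
    sum_eq_zero_iff] at h
  refine ⟨⟨Finsupp.toMultiset m, fun {i} hi => Nat.pos_of_ne_zero ?_, ?_⟩,
    Finsupp.toMultiset_toFinsupp m⟩
  · rintro rfl
    rw [Finsupp.mem_toMultiset] at hi
    have := h.2 0 hi
    simp [varWeight] at this
    simp [this] at hi
  · rw [Finsupp.sum_toMultiset]
    simpa [varWeight, Finsupp.sum] using h.1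

theorem map_eq_sum_partition {F : MvPolynomial ℕ ℚ} {n : ℕ}
    (hF : ∀ m, coeff m F ≠ 0 → ∃ μ : n.Partition, Multiset.toFinsupp μ.parts = m)
    {A : Type*} [AddCommGroup A] [Module ℚ A] (L : MvPolynomial ℕ ℚ →ₗ[ℚ] A) :
    L F = ∑ μ : n.Partition, coeff (Multiset.toFinsupp μ.parts) F •
      L (monomial (Multiset.toFinsupp μ.parts) 1) := by
  classical
  conv_lhs => rw [F.as_sum, map_sum]
  rw [← sum_image (s := univ) (g := fun μ : n.Partition => Multiset.toFinsupp μ.parts)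
    (f := fun m => coeff m F • L (monomial m 1)) (toFinsupp_parts_injective n).injOn]
  refine (sum_congr rfl fun m _ => ?_).trans (sum_subset (fun m hm => ?_) fun m _ hm => ?_)
  · rw [← map_smul, smul_monomial, smul_eq_mul, mul_one]
  · obtain ⟨μ, hμ⟩ := hF m (mem_support_iff.1 hm)
    exact mem_image.2 ⟨μ, mem_univ _, hμ⟩
  · rw [notMem_support_iff.1 hm, zero_smul]

theorem aeval_monomial_toFinsupp {A : Type*} [CommRing A] [Algebra ℚ A] (z : ℕ → A)
    (s : Multiset ℕ) : aeval (R := ℚ) z (monomial (Multiset.toFinsupp s) 1) = (s.map z).prod := by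
  rw [aeval_monomial, map_one, one_mul, Finset.prod_multiset_map_count, Finsupp.prod,
    Multiset.toFinsupp_support]
  simp only [Multiset.toFinsupp_apply]

/-- The scalar `∏ i, 1 / μ_i` relating `p̃_μ` to `p_μ`. -/
def tildeScalar {n : ℕ} (μ : n.Partition) : ℚ := (μ.parts.map fun k : ℕ => (1 / k : ℚ)).prod

theorem tildeScalar_ne_zero {n : ℕ} (μ : n.Partition) : tildeScalar μ ≠ 0 := by
  refine Multiset.prod_ne_zero fun h => ?_
  obtain ⟨k, hk, h0⟩ := Multiset.mem_map.1 h
  have := μ.parts_pos hk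
  have : (k : ℚ) ≠ 0 := by positivity
  exact one_div_ne_zero this h0

theorem psumTildePart_eq {n : ℕ} (μ : n.Partition) :
    psumTildePart μ = tildeScalar μ • psumPart μ := by
  simp only [psumTildePart, tildeScalar, psumPart, Algebra.smul_def, map_multiset_prod,
    Multiset.map_map, ← Multiset.prod_map_mul]
  rfl

theorem eq_of_sum_psumPart_eq {n : ℕ} {a b : n.Partition → ℚ}
    (h : ∑ μ, a μ • psumPart μ = ∑ μ, b μ • psumPart μ) : a = b := by
  rw [← sub_eq_zero, ← sum_sub_distrib] at h
  simp only [← sub_smul] at h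
  exact funext fun μ => sub_eq_zero.1
    (Fintype.linearIndependent_iff.1 (linearIndependent_psumPart n) _ h μ)

theorem eq_of_sum_psumTildePart_eq {n : ℕ} {a b : n.Partition → ℚ}
    (h : ∑ μ, a μ • psumTildePart μ = ∑ μ, b μ • psumTildePart μ) : a = b := by
  simp only [psumTildePart_eq, smul_smul] at h
  have h1 := eq_of_sum_psumPart_eq h
  exact funext fun μ => mul_right_cancel₀ (tildeScalar_ne_zero μ) (congrFun h1 μ)

theorem isLowestDegreePart_unique {n : ℕ} {f g g' : MvPowerSeries ℕ ℚ}
    (h : IsLowestDegreePart n f g) (h' : IsLowestDegreePart n f g') : g = g' := by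
  obtain ⟨a, r, ha, hr, hg⟩ := h
  obtain ⟨a', r', ha', hr', hg'⟩ := h'
  obtain rfl := eq_of_sum_psumPart_eq (ha.symm.trans ha')
  obtain rfl := hr.unique hr'
  rw [hg, hg']

/-- The polynomial in the variables `z_k = p_k / k` that expresses the bottom Schur function. -/
def bottomPoly (Y : YoungDiagram) : MvPolynomial ℕ ℚ := (bottomMatrix X (beta (Y.colLen 0) Y)).det

theorem rowLen_colLen_succ (Y : YoungDiagram) : Y.rowLen (Y.colLen 0 + 1) = 0 := by
  by_contra h
  have h1 := YoungDiagram.mem_iff_lt_colLen.1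
    (YoungDiagram.mem_iff_lt_rowLen.2 (Nat.pos_of_ne_zero h))
  lia

theorem degree_toFinsupp (s : Multiset ℕ) : (Multiset.toFinsupp s).degree = Multiset.card s := by
  rw [← Multiset.toFinsupp_sum_eq]
  rfl

theorem coeff_bottomPoly (Y : YoungDiagram) (m : ℕ →₀ ℕ) :
    coeff m (bottomPoly Y) = if m.degree = bottomDegree (beta (Y.colLen 0) Y) then
      coeff m (toeplitzMinor (PowerSeries.mk completePoly) (beta (Y.colLen 0) Y)) else 0 := by
  split_ifs with h
  · exact (coeff_toeplitzMinor_of_eq _ h).symm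
  · exact (isHomogeneous_det_bottomMatrix _).coeff_eq_zero h

theorem evalPsum_monomial {n : ℕ} (μ : n.Partition) :
    evalPsum (monomial (Multiset.toFinsupp μ.parts) 1) = psumTildePart μ :=
  aeval_monomial_toFinsupp _ _

theorem exists_partition_of_coeff_toeplitzMinor_ne_zero (Y : YoungDiagram) (m : ℕ →₀ ℕ)
    (hm : coeff m (toeplitzMinor (PowerSeries.mk completePoly) (beta (Y.colLen 0) Y)) ≠ 0) :
    ∃ μ : Y.card.Partition, Multiset.toFinsupp μ.parts = m :=
  exists_partition_of_coeff_ne_zero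
    (isWeightedHomogeneous_toeplitzMinor _ (sum_beta (rowLen_colLen_succ Y))) hm

theorem exists_partition_of_coeff_bottomPoly_ne_zero (Y : YoungDiagram) (m : ℕ →₀ ℕ)
    (hm : coeff m (bottomPoly Y) ≠ 0) :
    ∃ μ : Y.card.Partition, Multiset.toFinsupp μ.parts = m := by
  rw [coeff_bottomPoly] at hm
  split_ifs at hm with h
  · exact exists_partition_of_coeff_toeplitzMinor_ne_zero Y m hm
  · exact absurd rfl hm

theorem evalPsum_bottomPoly (Y : YoungDiagram) :
    evalPsum (bottomPoly Y) = ∑ μ : Y.card.Partition,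
      coeff (Multiset.toFinsupp μ.parts) (bottomPoly Y) • psumTildePart μ :=
  (map_eq_sum_partition (exists_partition_of_coeff_bottomPoly_ne_zero Y)
    evalPsum.toLinearMap).trans
    (sum_congr rfl fun μ _ => congrArg _ (evalPsum_monomial μ))

theorem isBottomSchur_bottomPoly (Y : YoungDiagram) :
    IsBottomSchur Y (evalPsum (bottomPoly Y)) := by
  set D := toeplitzMinor (PowerSeries.mk completePoly) (beta (Y.colLen 0) Y) with hD
  refine ⟨fun μ => coeff (Multiset.toFinsupp μ.parts) D * tildeScalar μ,
    bottomDegree (beta (Y.colLen 0) Y), ?_, ⟨?_, ?_⟩, ?_⟩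
  · rw [schur_eq (rowLen_colLen_succ Y)]
    refine (map_eq_sum_partition (exists_partition_of_coeff_toeplitzMinor_ne_zero Y)
      evalPsum.toLinearMap).trans (sum_congr rfl fun μ _ => ?_)
    rw [mul_smul, ← psumTildePart_eq, ← evalPsum_monomial]
    rfl
  -- The minimum is attained because the determinant of the bottom matrix is nonzero and homogeneous
  -- of that degree.
  · obtain ⟨m, hm⟩ := MvPolynomial.ne_zero_iff.1
      (det_bottomMatrix_ne_zero (strictMono_beta (Y.colLen 0) Y).injective)
    obtain ⟨μ, rfl⟩ := exists_partition_of_coeff_bottomPoly_ne_zero Y m hm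
    change coeff _ (bottomPoly Y) ≠ 0 at hm
    rw [coeff_bottomPoly] at hm
    split_ifs at hm with h
    · exact ⟨μ, mul_ne_zero hm (tildeScalar_ne_zero μ), by rw [← degree_toFinsupp, h]⟩
    · exact absurd rfl hm
  · rintro l ⟨μ, hμ, rfl⟩
    by_contra! hlt
    rw [← degree_toFinsupp] at hlt
    exact hμ (mul_eq_zero_of_left (coeff_toeplitzMinor_of_lt _ hlt) _)
  · rw [evalPsum_bottomPoly, sum_filter]
    refine sum_congr rfl fun μ _ => ?_
    rw [coeff_bottomPoly, degree_toFinsupp, psumTildePart_eq, smul_smul, ite_mul, zero_mul, ite_smul,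
      zero_smul]

theorem isBottomSchur_iff (Y : YoungDiagram) (s : MvPowerSeries ℕ ℚ) :
    IsBottomSchur Y s ↔ s = evalPsum (bottomPoly Y) :=
  ⟨fun h => isLowestDegreePart_unique h (isBottomSchur_bottomPoly Y),
    fun h => h ▸ isBottomSchur_bottomPoly Y⟩

theorem sum_psumPart_eq_sum_augMsymm (Y : YoungDiagram) :
    ∑ μ : Y.card.Partition, coeff (Multiset.toFinsupp μ.parts) (bottomPoly Y) • psumPart μ =
      ∑ μ : Y.card.Partition, coeff (Multiset.toFinsupp μ.parts) (bottomPoly Y) • augMsymm μ := by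
  have h := psumHom_det_bottomMatrix (beta (Y.colLen 0) Y)
  change psumHom.toLinearMap (bottomPoly Y) = augMap (bottomPoly Y) at h
  rw [map_eq_sum_partition (exists_partition_of_coeff_bottomPoly_ne_zero Y),
    map_eq_sum_partition (exists_partition_of_coeff_bottomPoly_ne_zero Y)] at h
  refine Eq.trans (sum_congr rfl fun μ _ => ?_) (h.trans (sum_congr rfl fun μ _ => ?_))
  · exact congrArg _ (aeval_monomial_toFinsupp psum μ.parts).symm
  · rw [augMap_monomial, Multiset.toFinsupp_toMultiset, augMsymm_eq]

end BottomSchur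

end

theorem mainTheorem3 (Y : YoungDiagram) :
    (∃! s : MvPowerSeries ℕ ℚ, BottomSchur.IsBottomSchur Y s) ∧
    ∀ s : MvPowerSeries ℕ ℚ, BottomSchur.IsBottomSchur Y s →
      (∃! c : Y.card.Partition → ℚ, s = ∑ μ, c μ • BottomSchur.psumTildePart μ) ∧
      ∀ c : Y.card.Partition → ℚ, s = ∑ μ, c μ • BottomSchur.psumTildePart μ →
        ∑ μ, c μ • BottomSchur.psumPart μ = ∑ μ, c μ • BottomSchur.augMsymm μ := by
  simp only [BottomSchur.isBottomSchur_iff]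
  refine ⟨existsUnique_eq, ?_⟩
  rintro s rfl
  rw [BottomSchur.evalPsum_bottomPoly]
  refine ⟨⟨_, rfl, fun c hc => (BottomSchur.eq_of_sum_psumTildePart_eq hc).symm⟩, fun c hc => ?_⟩
  -- Uniqueness identifies c with the coefficients of `bottomPoly`.
  rw [← BottomSchur.eq_of_sum_psumTildePart_eq hc]
  exact BottomSchur.sum_psumPart_eq_sum_augMsymm Y
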